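/- Let $n\ge 2$ and let $\boldsymbol\theta=(\theta_1,\dots,\theta_n)\in\mathbb R^n$ be such that $1,\theta_1,\dots,\theta_n$ are linearly independent over $\mathbb Q$. Let $\lambda$ (respectively $\hat\lambda$) be the supremum in $[-\infty,+\infty]$ of the real numbers $\gamma$ such that the system $$\max_{1\le i\le n}|x_0\theta_i-x_i|\le t^{-\gamma},\qquad 0<|x_0|\le t$$ has a solution $(x_0,\dots,x_n)\in\mathbb Z^{n+1}$ for some arbitrarily large real $t$ (respectively for every sufficiently large real $t$). Let $\omega$ (respectively $\hat\omega$) be the supremum of the real numbers $\gamma$ such that the system $$|x_0+\theta_1x_1+\dots+\theta_nx_n|\le t^{-\gamma},\qquad 0<\max_{1\le i\le n}|x_i|\le t$$ has a solution $(x_0,\dots,x_n)\in\mathbb Z^{n+1}$ for some arbitrarily large real $t$ (respectively for every sufficiently large real $t$). Then $$\frac{1+\omega}{1+\lambda}\ \ge\ \hat\omega\ \ge\ \frac{n-1}{1-\hat\lambda},\qquad \frac{1+\omega^{-1}}{1+\lambda^{-1}}\ \ge\ \hat\lambda\ \ge\ \frac{1-\hat\omega^{-1}}{n-1}.$$ In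 particular, the Bugeaud–Laurent inequalities hold: $$\frac{1+\omega}{1+\lambda}\ \ge\ \frac{n-1}{1-\hat\lambda},\qquad \frac{1+\omega^{-1}}{1+\lambda^{-1}}\ \ge\ \frac{1-\hat\omega^{-1}}{n-1}.$$ The exponents may take the value $+\infty$, with the conventions $(+\infty)^{-1}=0$, $a/(+\infty)=0$ for finite $a$, $a/0=+\infty$ for $a>0$, and $(+\infty)/b=+\infty$ for $0<b\le+\infty$; thus the first inequality means $\hat\omega(1+\lambda)\le 1+\omega$. -/

import Mathlib

open Filter

/-- The system `max_i |x₀ θ_i - x_i| ≤ t^(-γ)`, `0 < |x₀| ≤ t` has an integer solution. -/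
def SimSolvable {n : ℕ} (θ : Fin n → ℝ) (γ t : ℝ) : Prop :=
  ∃ (x₀ : ℤ) (x : Fin n → ℤ),
    (∀ i, |(x₀ : ℝ) * θ i - (x i : ℝ)| ≤ t ^ (-γ)) ∧ 0 < |(x₀ : ℝ)| ∧ |(x₀ : ℝ)| ≤ t

/-- The system `|x₀ + θ_1 x_1 + ... + θ_n x_n| ≤ t^(-γ)`, `0 < max_i |x_i| ≤ t` has an integer
solution. -/
def LinSolvable {n : ℕ} (θ : Fin n → ℝ) (γ t : ℝ) : Prop :=
  ∃ (x₀ : ℤ) (x : Fin n → ℤ),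
    |(x₀ : ℝ) + ∑ i, θ i * (x i : ℝ)| ≤ t ^ (-γ) ∧
      (∃ i, 0 < |(x i : ℝ)|) ∧ ∀ i, |(x i : ℝ)| ≤ t

/-- The regular exponent `λ(θ)` of simultaneous approximation; suprema are taken in `[-∞, +∞]`. -/
noncomputable def simExp {n : ℕ} (θ : Fin n → ℝ) : EReal :=
  sSup ((fun γ : ℝ => (γ : EReal)) '' {γ : ℝ | ∃ᶠ t : ℝ in atTop, SimSolvable θ γ t})

/-- The uniform exponent of simultaneous approximation. -/
noncomputable def simUnifExp {n : ℕ} (θ : Fin n → ℝ) : EReal :=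
  sSup ((fun γ : ℝ => (γ : EReal)) '' {γ : ℝ | ∀ᶠ t : ℝ in atTop, SimSolvable θ γ t})

/-- The regular exponent `ω(θ)` of the linear form. -/
noncomputable def linExp {n : ℕ} (θ : Fin n → ℝ) : EReal :=
  sSup ((fun γ : ℝ => (γ : EReal)) '' {γ : ℝ | ∃ᶠ t : ℝ in atTop, LinSolvable θ γ t})

/-- The uniform exponent of the linear form. -/
noncomputable def linUnifExp {n : ℕ} (θ : Fin n → ℝ) : EReal :=
  sSup ((fun γ : ℝ => (γ : EReal)) '' {γ : ℝ | ∀ᶠ t : ℝ in atTop, LinSolvable θ γ t})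

/-- The quotient `a / b` for `0 < a ≤ +∞` and `0 ≤ b ≤ +∞`, with the conventions `a / 0 = +∞` and
`+∞ / b = +∞` (also for `b = +∞`), so that `c ≤ a / b` means `c * b ≤ a` for every `c > 0`.
Mathlib's division on `EReal` has `a / 0 = 0` and `+∞ / +∞ = 0` instead; elsewhere the two agree. -/
noncomputable def extQuot (a b : EReal) : EReal :=
  open Classical in if b = 0 ∨ a = ⊤ then ⊤ else a / b

/-! The forms `x₀`, `x₀ θ_i - x_i` have a matrix A with A² = 1, and the transpose of A gives the
forms `y₀ + ∑ θ_i y_i`, `-y_i`. Hence the pairing of A z with Aᵀ w equals that of z with w. For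
integral z and w it is an integer, so it vanishes once it is known to be less than one in absolute
value. All four basic inequalities rest on this.

The lower bounds for the uniform exponents come from `exists_int_dual_of_family`, applied to A and
to Aᵀ. A vector w with Aᵀ w in a given box is sought. Let z be the shortest solution of the given
system at one parameter S. If the zeroth coordinate of A z is small, Minkowski's theorem with the
pairing with z among its forms produces w (`exists_int_of_vector`). Otherwise the uniform hypothesis
at half that coordinate produces z', which is not proportional to z because z is shortest. The
Plücker coordinates of A z and A z' are small, and Minkowski's theorem with both pairings among the
forms produces w (`exists_int_of_pair`).

The upper bounds combine a very good point for one problem with a uniformly available point for the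
other. Their pairing vanishes, so |x₀| times the value of the linear form at y is at most n · max
|y_i| · max |x₀ θ_i - x_i| (`abs_mul_linForm_le`). This improves the uniformly available point and
bounds a regular exponent from below: `frequently_linSolvable`, `frequently_simSolvable`. Linear
independence over ℚ makes denominators unbounded and values of the form nonzero.

The Bugeaud–Laurent inequalities follow by transitivity. -/

/-! ### Minkowski's theorem and the integral pairing -/

open Matrix in
/-- Minkowski's theorem on linear forms, with strict inequalities. -/
theorem exists_int_mulVec_lt {ι : Type*} [Fintype ι] [DecidableEq ι] (F : Matrix ι ι ℝ)
    (hF : F.det ≠ 0) (c : ι → ℝ) (hc : ∀ i, 0 < c i) (h : |F.det| < ∏ i, c i) :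
    ∃ z : ι → ℤ, z ≠ 0 ∧ ∀ i, |(F *ᵥ (fun j => (z j : ℝ))) i| < c i := by
  classical
  let f : (ι → ℝ) →ₗ[ℝ] (ι → ℝ) := Matrix.toLin' F
  let box : Set (ι → ℝ) := Set.univ.pi fun i => Set.Ioo (-c i) (c i)
  let K : Set (ι → ℝ) := f ⁻¹' box
  have hbox : MeasureTheory.volume box = ENNReal.ofReal (2 ^ Fintype.card ι * ∏ i, c i) := by
    rw [Real.volume_pi_Ioo, ← ENNReal.ofReal_prod_of_nonneg]
    · congr 1
      rw [← Finset.card_univ, ← Finset.prod_const, ← Finset.prod_mul_distrib]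
      exact Finset.prod_congr rfl fun i _ => by ring
    · intro i _; linarith [hc i]
  have hdet : LinearMap.det f = F.det := LinearMap.det_toLin' F
  have hK : MeasureTheory.volume K
      = ENNReal.ofReal |F.det|⁻¹ * ENNReal.ofReal (2 ^ Fintype.card ι * ∏ i, c i) := by
    rw [MeasureTheory.Measure.addHaar_preimage_linearMap _ (by rw [hdet]; exact hF), hdet, hbox,
      abs_inv]
  let b := Pi.basisFun ℝ ι
  have fund := ZSpan.isAddFundamentalDomain b MeasureTheory.volume
  have hsymm : ∀ x ∈ K, -x ∈ K := by
    intro x hx i hi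
    have := hx i hi
    simp only [map_neg, Pi.neg_apply, Set.mem_Ioo] at this ⊢
    constructor <;> linarith [this.1, this.2]
  have hconv : Convex ℝ K :=
    (convex_pi fun i _ => convex_Ioo _ _).linear_preimage f
  have hvol1 : MeasureTheory.volume (ZSpan.fundamentalDomain b) = 1 := by
    rw [ZSpan.fundamentalDomain_pi_basisFun, Real.volume_pi_Ico]; simp
  have hlt : MeasureTheory.volume (ZSpan.fundamentalDomain b) * 2 ^ Module.finrank ℝ (ι → ℝ)
      < MeasureTheory.volume K := by
    rw [hvol1, one_mul, hK, Module.finrank_fintype_fun_eq_card,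
      ← ENNReal.ofReal_mul (by positivity)]
    have : (2 : ENNReal) ^ Fintype.card ι = ENNReal.ofReal (2 ^ Fintype.card ι) := by
      rw [ENNReal.ofReal_pow (by norm_num)]; norm_num
    rw [this]
    have hd : 0 < |F.det| := abs_pos.mpr hF
    have key : (2 : ℝ) ^ Fintype.card ι < |F.det|⁻¹ * (2 ^ Fintype.card ι * ∏ i, c i) := by
      rw [inv_mul_eq_div, lt_div_iff₀ hd]
      exact mul_lt_mul_of_pos_left h (by positivity)
    exact (ENNReal.ofReal_lt_ofReal_iff (lt_trans (by positivity) key)).mpr key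
  have : Countable (Submodule.span ℤ (Set.range b)).toAddSubgroup := by
    change Countable (Submodule.span ℤ (Set.range b))
    infer_instance
  obtain ⟨x, hx0, hxK⟩ := MeasureTheory.exists_ne_zero_mem_lattice_of_measure_mul_two_pow_lt_measure
    (L := (Submodule.span ℤ (Set.range b)).toAddSubgroup) fund hsymm hconv hlt
  have hmem : ∀ i, ∃ m : ℤ, (m : ℝ) = (x : ι → ℝ) i := by
    have := x.2
    rw [Submodule.mem_toAddSubgroup, b.mem_span_iff_repr_mem ℤ] at this
    intro i
    obtain ⟨m, hm⟩ := this i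
    exact ⟨m, by simpa [b] using hm⟩
  choose z hz using hmem
  have hzx : (fun j => (z j : ℝ)) = (x : ι → ℝ) := funext hz
  refine ⟨z, ?_, fun i => ?_⟩
  · rintro rfl
    apply hx0
    ext i
    simpa using (hz i).symm
  · have := hxK i (Set.mem_univ i)
    rw [hzx, abs_lt]
    exact this

/-- An involutive matrix preserves the pairing of integer vectors, up to transposition. -/
theorem mulVec_dotProduct_transpose_mulVec {ι : Type*} [Fintype ι] [DecidableEq ι]
    (A : Matrix ι ι ℝ) (hA : A * A = 1) (v w : ι → ℝ) :
    ∑ j, A.mulVec v j * A.transpose.mulVec w j = ∑ j, v j * w j := by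
  change A.mulVec v ⬝ᵥ A.transpose.mulVec w = v ⬝ᵥ w
  rw [Matrix.dotProduct_mulVec, Matrix.vecMul_transpose, Matrix.mulVec_mulVec, hA,
    Matrix.one_mulVec]

theorem abs_det_eq_one_of_mul_self {ι : Type*} [Fintype ι] [DecidableEq ι]
    (A : Matrix ι ι ℝ) (hA : A * A = 1) : |A.det| = 1 := by
  have h : A.det * A.det = 1 := by rw [← Matrix.det_mul, hA, Matrix.det_one]
  have h' : |A.det| * |A.det| = 1 := by rw [← abs_mul, h, abs_one]
  nlinarith [abs_nonneg A.det]

/-- Minkowski's theorem for F Aᵀ: since |det A| = 1, passing to the coordinates Aᵀ w costs nothing.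
-/
theorem exists_int_transpose_mulVec_lt {ι : Type*} [Fintype ι] [DecidableEq ι]
    (A : Matrix ι ι ℝ) (hA : A * A = 1) (F : Matrix ι ι ℝ)
    (hF : F.det ≠ 0) (c : ι → ℝ) (hc : ∀ i, 0 < c i) (h : |F.det| < ∏ i, c i) :
    ∃ w : ι → ℤ, w ≠ 0 ∧
      ∀ i, |∑ j, F i j * A.transpose.mulVec (fun j => (w j : ℝ)) j| < c i := by
  have hd := abs_det_eq_one_of_mul_self A hA
  obtain ⟨w, hw, hlt⟩ := exists_int_mulVec_lt (F * A.transpose)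
    (by
      rw [Matrix.det_mul, Matrix.det_transpose]
      refine mul_ne_zero hF fun h0 => ?_
      rw [h0] at hd
      simp at hd) c hc
    (by rwa [Matrix.det_mul, Matrix.det_transpose, abs_mul, hd, mul_one])
  refine ⟨w, hw, fun i => ?_⟩
  have := hlt i
  rw [← Matrix.mulVec_mulVec] at this
  exact this

/-- Integers of absolute value less than one vanish, applied to a pairing. -/
theorem sum_mul_eq_zero_of_abs_lt_one {ι : Type*} [Fintype ι] (z w : ι → ℤ)
    (h : |∑ j, (z j : ℝ) * (w j : ℝ)| < 1) : ∑ j, (z j : ℝ) * (w j : ℝ) = 0 := by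
  have : |∑ j, z j * w j| < 1 := by exact_mod_cast h
  exact_mod_cast Int.abs_lt_one_iff.mp this

/-- The matrix is 1 + U V with U of two columns, and det (1 + U V) = det (1 + V U) leaves a 2 × 2
determinant. -/
theorem det_one_row_updates {ι : Type*} [Fintype ι] [DecidableEq ι] (a a' : ι → ℝ) (k l : ι)
    (hkl : k ≠ l) :
    (Matrix.of fun i j => if i = k then a j else if i = l then a' j else (1 : Matrix ι ι ℝ) i j).det
      = a k * a' l - a l * a' k := by
  let U : Matrix ι (Fin 2) ℝ := Matrix.of fun i => ![if i = k then 1 else 0, if i = l then 1 else 0]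
  let V : Matrix (Fin 2) ι ℝ := Matrix.of ![fun j => a j - (1 : Matrix ι ι ℝ) k j,
    fun j => a' j - (1 : Matrix ι ι ℝ) l j]
  have hF : (Matrix.of fun i j => if i = k then a j else if i = l then a' j
      else (1 : Matrix ι ι ℝ) i j) = 1 + U * V := by
    ext i j
    simp only [Matrix.of_apply, Matrix.add_apply, Matrix.mul_apply, Fin.sum_univ_two, U, V]
    by_cases h1 : i = k
    · subst h1; simp [hkl]
    · by_cases h2 : i = l
      · subst h2; simp [h1]
      · simp [h1, h2]
  have hVU : V * U = !![a k - 1, a l; a' k, a' l - 1] := by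
    ext s t
    rw [Matrix.mul_apply]
    fin_cases s <;> fin_cases t <;> simp [U, V, Matrix.one_apply, hkl, hkl.symm]
  rw [hF, Matrix.det_one_add_mul_comm, hVU, Matrix.det_fin_two]
  simp

theorem det_one_row_update {ι : Type*} [Fintype ι] [DecidableEq ι] (a : ι → ℝ) (k : ι) :
    (Matrix.of fun i j => if i = k then a j else (1 : Matrix ι ι ℝ) i j).det = a k := by
  have hF : (Matrix.of fun i j => if i = k then a j else (1 : Matrix ι ι ℝ) i j)
      = Matrix.updateRow 1 k a := by
    ext i j
    by_cases h1 : i = k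
    · subst h1; simp
    · simp [h1]
  rw [hF, ← Matrix.cramer_transpose_apply, Matrix.transpose_one, Matrix.cramer_one]
  rfl

/-! ### Integer vectors orthogonal to one or two given vectors, in a dual box -/

/-- A nonzero integer vector orthogonal to `z` in a box dual to the coordinates of `A z`. -/
theorem exists_int_of_vector {ι : Type*} [Fintype ι] [DecidableEq ι] (A : Matrix ι ι ℝ)
    (hA : A * A = 1) (β : ι → ℝ) (hβ : ∀ i, 0 < β i) (a : ι → ℝ) (z : ι → ℤ)
    (ha : a = A.mulVec fun j => (z j : ℝ)) (ha0 : ∃ k, a k ≠ 0) (hN : 2 ≤ Fintype.card ι)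
    (h : ∀ k, (Fintype.card ι : ℝ) ^ Fintype.card ι * (|a k| * β k) ≤ ∏ i, β i) :
    ∃ w : ι → ℤ, w ≠ 0 ∧ ∀ k, |A.transpose.mulVec (fun j => (w j : ℝ)) k| ≤ β k := by
  set N : ℝ := (Fintype.card ι : ℝ) with hNdef
  have hN2 : (2 : ℝ) ≤ N := by rw [hNdef]; exact_mod_cast hN
  have hN0 : 0 < N := by linarith
  obtain ⟨k0, hk0⟩ := ha0
  -- The pairing takes the place of coordinate k among the forms. Maximality of |a k| β k lets that
  -- coordinate be recovered from the relation ∑ a j b j = 0.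
  obtain ⟨k, -, hk⟩ := Finset.exists_max_image Finset.univ (fun k => |a k| * β k)
    ⟨k0, Finset.mem_univ _⟩
  have hak : 0 < |a k| := by
    have h1 := hk k0 (Finset.mem_univ _)
    have h2 : 0 < |a k0| * β k0 := mul_pos (abs_pos.mpr hk0) (hβ k0)
    exact pos_of_mul_pos_left (h2.trans_le h1) (hβ k).le
  -- The factor 1 / N absorbs the sum of at most N terms that bounds coordinate k.
  let c : ι → ℝ := fun i => if i = k then 1 else β i / N
  have hc : ∀ i, 0 < c i := by
    intro i; simp only [c]; split_ifs
    · exact one_pos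
    · exact div_pos (hβ i) hN0
  have hprod : (∏ i, c i) * (β k / N) = (∏ i, β i) / N ^ Fintype.card ι := by
    rw [← Finset.card_univ, ← Finset.prod_const, ← Finset.prod_div_distrib,
      ← Finset.mul_prod_erase Finset.univ (fun i => β i / N) (Finset.mem_univ k),
      ← Finset.mul_prod_erase Finset.univ c (Finset.mem_univ k)]
    have : ∏ x ∈ Finset.univ.erase k, c x = ∏ x ∈ Finset.univ.erase k, β x / N :=
      Finset.prod_congr rfl fun i hi => by simp [c, Finset.ne_of_mem_erase hi]
    rw [this]
    simp only [c, if_true]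
    ring
  have hlt : |a k| < ∏ i, c i := by
    have h1 : |a k| * β k ≤ (∏ i, β i) / N ^ Fintype.card ι := by
      rw [le_div_iff₀ (by positivity)]; linarith [h k]
    rw [← hprod] at h1
    have h2 : 0 < ∏ i, c i := Finset.prod_pos fun i _ => hc i
    have h3 : |a k| ≤ (∏ i, c i) / N := by
      refine le_of_mul_le_mul_right (h1.trans (le_of_eq ?_)) (hβ k)
      ring
    refine h3.trans_lt (div_lt_self h2 (by linarith))
  obtain ⟨w, hw, hwlt⟩ := exists_int_transpose_mulVec_lt A hA
    (Matrix.of fun i j => if i = k then a j else (1 : Matrix ι ι ℝ) i j)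
    (by rw [det_one_row_update]; exact abs_pos.mp hak) c hc
    (by rw [det_one_row_update]; exact hlt)
  set b := A.transpose.mulVec (fun j => (w j : ℝ)) with hb
  have hab : ∑ j, a j * b j = 0 := by
    rw [ha, hb, mulVec_dotProduct_transpose_mulVec A hA]
    apply sum_mul_eq_zero_of_abs_lt_one
    have := hwlt k
    simp only [Matrix.of_apply, if_true, c] at this
    rwa [ha, hb, mulVec_dotProduct_transpose_mulVec A hA] at this
  have hbj : ∀ j, j ≠ k → |b j| ≤ β j / N := by
    intro j hj
    have := hwlt j
    simp only [Matrix.of_apply, hj, if_false, c, Matrix.one_apply, ite_mul, one_mul, zero_mul,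
      Finset.sum_ite_eq, Finset.mem_univ, if_true] at this
    exact this.le
  refine ⟨w, hw, fun j => ?_⟩
  by_cases hj : j = k
  · subst hj
    rw [← Finset.add_sum_erase _ _ (Finset.mem_univ j)] at hab
    have h1 : |a j| * |b j| ≤ ∑ i ∈ Finset.univ.erase j, |a j| * β j / N := by
      rw [← abs_mul, eq_neg_of_add_eq_zero_left hab, abs_neg]
      refine (Finset.abs_sum_le_sum_abs _ _).trans (Finset.sum_le_sum fun i hi => ?_)
      rw [abs_mul]
      calc |a i| * |b i| ≤ |a i| * (β i / N) :=
            mul_le_mul_of_nonneg_left (hbj i (Finset.ne_of_mem_erase hi)) (abs_nonneg _)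
        _ = |a i| * β i / N := by ring
        _ ≤ |a j| * β j / N := by gcongr ?_ / _; exact hk i (Finset.mem_univ i)
    rw [Finset.sum_const, nsmul_eq_mul] at h1
    have h2 : ((Finset.univ.erase j).card : ℝ) ≤ N := by
      rw [hNdef]; exact_mod_cast Finset.card_le_univ _
    have h3 : |a j| * |b j| ≤ |a j| * β j := by
      refine h1.trans ?_
      have : 0 ≤ |a j| * β j / N := by have := hβ j; positivity
      calc _ ≤ N * (|a j| * β j / N) := mul_le_mul_of_nonneg_right h2 this
        _ = _ := by field_simp
    exact le_of_mul_le_mul_left h3 hak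
  · exact (hbj j hj).trans (div_le_self (hβ j).le (by linarith))

/-- A nonzero integer vector orthogonal to both `z` and `z'` in a box dual to the Plücker
coordinates of `A z` and `A z'`. -/
theorem exists_int_of_pair {ι : Type*} [Fintype ι] [DecidableEq ι] (A : Matrix ι ι ℝ)
    (hA : A * A = 1) (β : ι → ℝ) (hβ : ∀ i, 0 < β i) (a a' : ι → ℝ) (z z' : ι → ℤ)
    (ha : a = A.mulVec fun j => (z j : ℝ)) (ha' : a' = A.mulVec fun j => (z' j : ℝ))
    (hind : ∃ k l, a k * a' l - a l * a' k ≠ 0) (hN : 2 ≤ Fintype.card ι)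
    (h : ∀ k l, k ≠ l → (Fintype.card ι : ℝ) ^ Fintype.card ι *
      (|a k * a' l - a l * a' k| * (β k * β l)) ≤ ∏ i, β i) :
    ∃ w : ι → ℤ, w ≠ 0 ∧ ∀ k, |A.transpose.mulVec (fun j => (w j : ℝ)) k| ≤ β k := by
  set N : ℝ := (Fintype.card ι : ℝ) with hNdef
  have hN2 : (2 : ℝ) ≤ N := by rw [hNdef]; exact_mod_cast hN
  have hN0 : 0 < N := by linarith
  obtain ⟨k0, l0, hkl0⟩ := hind
  set m : ι → ι → ℝ := fun k l => |a k * a' l - a l * a' k| with hm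
  -- Two coordinates now give way to pairings; they are those of the largest weighted Plücker
  -- coordinate, which is also the determinant of the system up to sign.
  obtain ⟨⟨k, l⟩, -, hmax⟩ := Finset.exists_max_image (Finset.univ : Finset (ι × ι))
    (fun p => m p.1 p.2 * (β p.1 * β p.2)) ⟨(k0, l0), Finset.mem_univ _⟩
  have hmkl : 0 < m k l := by
    have h1 := hmax (k0, l0) (Finset.mem_univ _)
    have h2 : 0 < m k0 l0 * (β k0 * β l0) :=
      mul_pos (abs_pos.mpr hkl0) (mul_pos (hβ k0) (hβ l0))
    exact pos_of_mul_pos_left (h2.trans_le h1) (mul_pos (hβ k) (hβ l)).le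
  have hkl : k ≠ l := by
    rintro rfl
    simp [hm] at hmkl
  have hmsymm : ∀ i j, m i j = m j i := by
    intro i j
    simp only [hm]
    rw [← abs_neg]
    congr 1
    ring
  let c : ι → ℝ := fun i => if i = k then 1 else if i = l then 1 else β i / N
  have hc : ∀ i, 0 < c i := by
    intro i; simp only [c]; split_ifs
    · exact one_pos
    · exact one_pos
    · exact div_pos (hβ i) hN0
  have hlk : l ∈ Finset.univ.erase k := Finset.mem_erase.mpr ⟨hkl.symm, Finset.mem_univ l⟩
  have hprod : (∏ i, c i) * (β k / N * (β l / N)) = (∏ i, β i) / N ^ Fintype.card ι := by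
    rw [← Finset.card_univ, ← Finset.prod_const, ← Finset.prod_div_distrib,
      ← Finset.mul_prod_erase Finset.univ (fun i => β i / N) (Finset.mem_univ k),
      ← Finset.mul_prod_erase Finset.univ c (Finset.mem_univ k),
      ← Finset.mul_prod_erase _ (fun i => β i / N) hlk,
      ← Finset.mul_prod_erase _ c hlk]
    have : ∏ x ∈ (Finset.univ.erase k).erase l, c x
        = ∏ x ∈ (Finset.univ.erase k).erase l, β x / N :=
      Finset.prod_congr rfl fun i hi => by
        simp [c, Finset.ne_of_mem_erase hi, Finset.ne_of_mem_erase (Finset.mem_of_mem_erase hi)]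
    rw [this]
    simp only [c, if_true, hkl.symm, if_false]
    ring
  have hlt : m k l < ∏ i, c i := by
    have h1 : m k l * (β k * β l) ≤ (∏ i, β i) / N ^ Fintype.card ι := by
      rw [le_div_iff₀ (by positivity)]; linarith [h k l hkl]
    rw [← hprod] at h1
    have h2 : 0 < ∏ i, c i := Finset.prod_pos fun i _ => hc i
    have h3 : m k l ≤ (∏ i, c i) / (N * N) := by
      refine le_of_mul_le_mul_right (h1.trans (le_of_eq ?_)) (mul_pos (hβ k) (hβ l))
      field_simp
    refine h3.trans_lt (div_lt_self h2 (by nlinarith))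
  obtain ⟨w, hw, hwlt⟩ := exists_int_transpose_mulVec_lt A hA
    (Matrix.of fun i j => if i = k then a j else if i = l then a' j else (1 : Matrix ι ι ℝ) i j)
    (by rw [det_one_row_updates _ _ _ _ hkl]; exact abs_pos.mp hmkl) c hc
    (by rw [det_one_row_updates _ _ _ _ hkl]; exact hlt)
  set b := A.transpose.mulVec (fun j => (w j : ℝ)) with hb
  have hab : ∑ j, a j * b j = 0 := by
    rw [ha, hb, mulVec_dotProduct_transpose_mulVec A hA]
    apply sum_mul_eq_zero_of_abs_lt_one
    have := hwlt k
    simp only [Matrix.of_apply, if_true, c] at this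
    rwa [ha, hb, mulVec_dotProduct_transpose_mulVec A hA] at this
  have hab' : ∑ j, a' j * b j = 0 := by
    rw [ha', hb, mulVec_dotProduct_transpose_mulVec A hA]
    apply sum_mul_eq_zero_of_abs_lt_one
    have := hwlt l
    simp only [Matrix.of_apply, if_true, c, hkl.symm, if_false] at this
    rwa [ha', hb, mulVec_dotProduct_transpose_mulVec A hA] at this
  have hbj : ∀ j, j ≠ k → j ≠ l → |b j| ≤ β j / N := by
    intro j hj hj'
    have := hwlt j
    simp only [Matrix.of_apply, hj, hj', if_false, c, Matrix.one_apply, ite_mul, one_mul, zero_mul,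
      Finset.sum_ite_eq, Finset.mem_univ, if_true] at this
    exact this.le
  -- Eliminating b q from the two relations leaves Plücker coordinates as coefficients, so b p can
  -- be solved for with p, q = k, l or l, k.
  have hzero : ∀ q, ∑ j, (a j * a' q - a q * a' j) * b j = 0 := by
    intro q
    calc ∑ j, (a j * a' q - a q * a' j) * b j
        = a' q * ∑ j, a j * b j - a q * ∑ j, a' j * b j := by
          rw [Finset.mul_sum, Finset.mul_sum, ← Finset.sum_sub_distrib]
          exact Finset.sum_congr rfl fun j _ => by ring
      _ = 0 := by rw [hab, hab']; ring
  have main : ∀ p q, p ≠ q → (∀ j, j ≠ p → j ≠ q → |b j| ≤ β j / N) → 0 < m p q →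
      (∀ i j, m i j * (β i * β j) ≤ m p q * (β p * β q)) → |b p| ≤ β p := by
    intro p q hpq hbj hpos hmax
    have h0 := hzero q
    rw [← Finset.add_sum_erase _ _ (Finset.mem_univ p)] at h0
    have h1 : m p q * |b p| ≤ ∑ i ∈ Finset.univ.erase p, m p q * β p / N := by
      simp only [hm]
      rw [← abs_mul, eq_neg_of_add_eq_zero_left h0, abs_neg]
      refine (Finset.abs_sum_le_sum_abs _ _).trans (Finset.sum_le_sum fun i hi => ?_)
      rw [abs_mul]
      by_cases hiq : i = q
      · subst hiq
        have := hβ p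
        simp only [sub_self, mul_comm (a i) (a' i), abs_zero, zero_mul]
        positivity
      have h3 : m i q * β i ≤ m p q * β p :=
        le_of_mul_le_mul_right (by linarith [hmax i q]) (hβ q)
      calc m i q * |b i| ≤ m i q * (β i / N) :=
            mul_le_mul_of_nonneg_left (hbj i (Finset.ne_of_mem_erase hi) hiq) (abs_nonneg _)
        _ = m i q * β i / N := by ring
        _ ≤ m p q * β p / N := by gcongr ?_ / _
    rw [Finset.sum_const, nsmul_eq_mul] at h1
    have h2 : ((Finset.univ.erase p).card : ℝ) ≤ N := by
      rw [hNdef]; exact_mod_cast Finset.card_le_univ _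
    have h3 : m p q * |b p| ≤ m p q * β p := by
      refine h1.trans ?_
      have : 0 ≤ m p q * β p / N := by have := hβ p; positivity
      calc _ ≤ N * (m p q * β p / N) := mul_le_mul_of_nonneg_right h2 this
        _ = _ := by field_simp
    exact le_of_mul_le_mul_left h3 hpos
  refine ⟨w, hw, fun j => ?_⟩
  by_cases hj : j = k
  · subst hj
    exact main j l hkl hbj hmkl fun i j' => hmax (i, j') (Finset.mem_univ _)
  by_cases hj' : j = l
  · subst hj'
    refine main j k hkl.symm (fun i h1 h2 => hbj i h2 h1) (by rwa [hmsymm]) fun i j' => ?_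
    rw [hmsymm j k, mul_comm (β j)]
    exact hmax (i, j') (Finset.mem_univ _)
  · exact (hbj j hj hj').trans (div_le_self (hβ j).le (by linarith))

/-! ### Transference for a family of boxes -/

/-- If `A z` and `A z'` are proportional, with a ratio less than one, then `z'` is shorter
than `z`. -/
theorem sum_natAbs_lt_of_mulVec_eq {ι : Type*} [Fintype ι] [DecidableEq ι] (A : Matrix ι ι ℝ)
    (hA : A * A = 1) (z z' : ι → ℤ) (hz : z ≠ 0) (ρ : ℝ) (hρ : |ρ| < 1)
    (h : A.mulVec (fun j => (z' j : ℝ)) = ρ • A.mulVec (fun j => (z j : ℝ))) :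
    ∑ i, (z' i).natAbs < ∑ i, (z i).natAbs := by
  have h1 : (fun j => (z' j : ℝ)) = ρ • (fun j => (z j : ℝ)) := by
    have := congrArg A.mulVec h
    rwa [Matrix.mulVec_smul, Matrix.mulVec_mulVec, Matrix.mulVec_mulVec, hA, Matrix.one_mulVec,
      Matrix.one_mulVec] at this
  have h2 : ∀ i, |(z' i : ℝ)| = |ρ| * |(z i : ℝ)| := by
    intro i
    rw [← abs_mul]
    exact congrArg abs (congrFun h1 i)
  obtain ⟨i, hi⟩ := Function.ne_iff.mp hz
  have h3 : ∑ i, |(z' i : ℝ)| < ∑ i, |(z i : ℝ)| := by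
    refine Finset.sum_lt_sum (fun j _ => ?_) ⟨i, Finset.mem_univ i, ?_⟩
    · rw [h2]
      exact mul_le_of_le_one_left (abs_nonneg _) hρ.le
    · rw [h2]
      have : 0 < |(z i : ℝ)| := abs_pos.mpr (by exact_mod_cast hi)
      exact mul_lt_of_lt_one_left this hρ
  have h4 : ∀ u : ι → ℤ, ((∑ i, (u i).natAbs : ℕ) : ℝ) = ∑ i, |(u i : ℝ)| := by
    intro u
    push_cast
    exact Finset.sum_congr rfl fun j _ => by rw [Nat.cast_natAbs, Int.cast_abs]
  rw [← h4, ← h4] at h3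
  exact_mod_cast h3

/-- Transference for a one-parameter family of boxes: solvability of the system
`|(A z)₀| ≤ r`, `|(A z)ᵢ| ≤ r ^ (-g)` for a range of `r` gives a solution of a dual system. -/
theorem exists_int_dual_of_family {n : ℕ} (hn : 1 ≤ n) (A : Matrix (Fin (n + 1)) (Fin (n + 1)) ℝ)
    (hA : A * A = 1) (S η g c : ℝ) (hS : 0 < S) (hη : 0 < η) (hg0 : 0 < g) (hg1 : g < 1)
    (hc : c = ((n + 1 : ℕ) : ℝ) ^ (n + 1))
    (h : ∀ r, min S (η ^ n / (2 * c)) ≤ r → r ≤ S → ∃ z : Fin (n + 1) → ℤ, z ≠ 0 ∧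
      |A.mulVec (fun j => (z j : ℝ)) 0| ≤ r ∧
      ∀ i : Fin n, |A.mulVec (fun j => (z j : ℝ)) i.succ| ≤ r ^ (-g))
    (h3 : 4 * c ^ 2 * S ^ (1 - g) ≤ η ^ (n - 1)) (h4 : η ≤ η ^ ((n : ℝ) * g)) :
    ∃ w : Fin (n + 1) → ℤ, w ≠ 0 ∧
      |A.transpose.mulVec (fun j => (w j : ℝ)) 0| ≤ S⁻¹ ∧
      ∀ i : Fin n, |A.transpose.mulVec (fun j => (w j : ℝ)) i.succ| ≤ η := by
  have hc1 : 1 ≤ c := by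
    rw [hc]
    exact one_le_pow₀ (by push_cast; linarith [(Nat.cast_nonneg n : (0 : ℝ) ≤ n)])
  have hηn : η ^ n = η ^ (n - 1) * η := by rw [← pow_succ, Nat.sub_add_cancel hn]
  have hT : 0 < S ^ (1 - g) := Real.rpow_pos_of_pos hS _
  have hSg : S ^ (1 - g) = S * S ^ (-g) := by
    rw [sub_eq_add_neg, Real.rpow_add hS, Real.rpow_one]
  set β : Fin (n + 1) → ℝ := Fin.cons S⁻¹ (fun _ => η) with hβdef
  have hβ0 : β 0 = S⁻¹ := rfl
  have hβs : ∀ i : Fin n, β i.succ = η := fun i => rfl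
  have hβ : ∀ i, 0 < β i := by
    intro i
    refine Fin.cases ?_ (fun i => ?_) i
    · rw [hβ0]; positivity
    · rw [hβs]; exact hη
  have hprod : ∏ i, β i = S⁻¹ * η ^ n := by
    rw [Fin.prod_univ_succ]
    simp [hβ0, hβs]
  have hcard : (Fintype.card (Fin (n + 1)) : ℝ) ^ Fintype.card (Fin (n + 1)) = c := by
    rw [Fintype.card_fin, hc]
  have hN : 2 ≤ Fintype.card (Fin (n + 1)) := by rw [Fintype.card_fin]; omega
  suffices ∃ w : Fin (n + 1) → ℤ, w ≠ 0 ∧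
      ∀ k, |A.transpose.mulVec (fun j => (w j : ℝ)) k| ≤ β k by
    obtain ⟨w, hw, hwb⟩ := this
    exact ⟨w, hw, hwb 0, fun i => hwb i.succ⟩
  -- A solution at parameter S of least ℓ¹ norm is chosen; its minimality later excludes a
  -- proportional second solution.
  let P : ℕ → Prop := fun k => ∃ z : Fin (n + 1) → ℤ, (z ≠ 0 ∧
      |A.mulVec (fun j => (z j : ℝ)) 0| ≤ S ∧
      ∀ i : Fin n, |A.mulVec (fun j => (z j : ℝ)) i.succ| ≤ S ^ (-g)) ∧ ∑ i, (z i).natAbs = k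
  have hP : ∃ k, P k := by
    obtain ⟨z, hz⟩ := h S (min_le_left _ _) le_rfl
    exact ⟨_, z, hz, rfl⟩
  classical
  obtain ⟨z, ⟨hz0, hzS, hzi⟩, hzk⟩ := Nat.find_spec hP
  have hmin : ∀ u : Fin (n + 1) → ℤ, u ≠ 0 → |A.mulVec (fun j => (u j : ℝ)) 0| ≤ S →
      (∀ i : Fin n, |A.mulVec (fun j => (u j : ℝ)) i.succ| ≤ S ^ (-g)) →
      ∑ i, (z i).natAbs ≤ ∑ i, (u i).natAbs := by
    intro u h1 h2 h3
    rw [hzk]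
    exact Nat.find_min' hP ⟨u, ⟨h1, h2, h3⟩, rfl⟩
  obtain ⟨a, ha⟩ : ∃ a, a = A.mulVec (fun j => (z j : ℝ)) := ⟨_, rfl⟩
  rw [← ha] at hzS hzi
  have hηn0 : 0 < η ^ n := pow_pos hη n
  by_cases hcase : c * |a 0| ≤ η ^ n
  · refine exists_int_of_vector A hA β hβ a z ha ?_ hN fun k => ?_
    · by_contra! hzero
      have h0 : a = 0 := funext hzero
      have h1 := congrArg A.mulVec (ha.symm.trans h0)
      rw [Matrix.mulVec_mulVec, hA, Matrix.one_mulVec, Matrix.mulVec_zero] at h1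
      exact hz0 (funext fun i => by simpa using congrFun h1 i)
    · rw [hcard, hprod]
      refine Fin.cases ?_ (fun i => ?_) k
      · rw [hβ0]
        have : 0 < S⁻¹ := by positivity
        nlinarith
      · rw [hβs, hηn, inv_mul_eq_div, le_div_iff₀ hS]
        calc c * (|a i.succ| * η) * S ≤ c * (S ^ (-g) * η) * S := by gcongr; exact hzi i
          _ = c * S ^ (1 - g) * η := by rw [hSg]; ring
          _ ≤ η ^ (n - 1) * η := by
              gcongr
              refine le_trans ?_ h3
              gcongr
              nlinarith
  · push Not at hcase
    have hp : 0 < |a 0| := by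
      by_contra! h0
      nlinarith
    -- At this parameter a solution proportional to z has ratio at most 1/2 in absolute value, so it
    -- is shorter and still solves the system at S. Failure of `hcase` keeps r within the range of
    -- `h`.
    set r := |a 0| / 2 with hr
    have hr0 : 0 < r := by positivity
    have hrη : η ^ n / (2 * c) ≤ r := by
      rw [div_le_iff₀ (by positivity), hr]
      linarith
    have hrS : r ≤ S := by rw [hr]; linarith
    obtain ⟨z', hz0', hzr', hzi'⟩ := h r ((min_le_right _ _).trans hrη) hrS
    obtain ⟨a', ha'⟩ : ∃ a', a' = A.mulVec (fun j => (z' j : ℝ)) := ⟨_, rfl⟩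
    rw [← ha'] at hzr' hzi'
    -- The lower bound for r enters here; `h4` then replaces η ^ (n g) by η in the denominator.
    have hq' : r ^ (-g) ≤ 2 * c / η := by
      calc r ^ (-g) ≤ (η ^ n / (2 * c)) ^ (-g) :=
            Real.rpow_le_rpow_of_nonpos (by positivity) hrη (by linarith)
        _ = (2 * c) ^ g / η ^ ((n : ℝ) * g) := by
            rw [Real.div_rpow (by positivity) (by positivity), Real.rpow_neg (by positivity),
              Real.rpow_neg (by positivity), Real.rpow_mul hη.le, Real.rpow_natCast]
            field_simp
        _ ≤ 2 * c / η := by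
            gcongr
            calc (2 * c) ^ g ≤ (2 * c) ^ (1 : ℝ) :=
                  Real.rpow_le_rpow_of_exponent_le (by linarith) hg1.le
              _ = 2 * c := Real.rpow_one _
    have hrr : r * r ^ (-g) ≤ S ^ (1 - g) := by
      calc r * r ^ (-g) = r ^ (1 - g) := by
            rw [sub_eq_add_neg, Real.rpow_add hr0, Real.rpow_one]
        _ ≤ S ^ (1 - g) := Real.rpow_le_rpow hr0.le hrS (by linarith)
    have hSg0 : 0 < S ^ (-g) := Real.rpow_pos_of_pos hS _
    have hmixed : ∀ i : Fin n, c * (|a 0 * a' i.succ - a i.succ * a' 0| * (S⁻¹ * η))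
        ≤ S⁻¹ * η ^ n := by
      intro i
      -- The large coordinate a 0 = 2 r meets the bound r ^ (-g), and r ^ (1 - g) increases with r
      -- because g < 1.
      have h5 : |a 0 * a' i.succ - a i.succ * a' 0| ≤ 3 * S ^ (1 - g) := by
        calc _ ≤ |a 0 * a' i.succ| + |a i.succ * a' 0| := abs_sub _ _
          _ = |a 0| * |a' i.succ| + |a i.succ| * |a' 0| := by rw [abs_mul, abs_mul]
          _ ≤ (2 * r) * r ^ (-g) + S ^ (-g) * S := by
              gcongr
              · exact (by rw [hr]; ring : |a 0| = 2 * r).le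
              · exact hzi' i
              · exact hzi i
              · exact hzr'.trans hrS
          _ ≤ 3 * S ^ (1 - g) := by rw [hSg] at hrr ⊢; linarith
      calc _ ≤ c * (3 * S ^ (1 - g) * (S⁻¹ * η)) := by gcongr
        _ = S⁻¹ * ((3 * c) * S ^ (1 - g) * η) := by ring
        _ ≤ S⁻¹ * ((4 * c ^ 2) * S ^ (1 - g) * η) := by
            gcongr ?_ * (?_ * _ * _)
            nlinarith
        _ ≤ S⁻¹ * η ^ n := by rw [hηn]; gcongr
    refine exists_int_of_pair A hA β hβ a a' z z' ha ha' ?_ hN fun k l hkl => ?_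
    · by_contra! hdep
      have hρ : |a' 0 / a 0| < 1 := by
        rw [abs_div, div_lt_one hp]
        rw [hr] at hzr'
        linarith
      have hprop : a' = (a' 0 / a 0) • a := by
        funext l
        have := hdep 0 l
        have h0 : a 0 ≠ 0 := abs_pos.mp hp
        rw [Pi.smul_apply, smul_eq_mul]
        field_simp
        linarith
      have hle : ∀ l, |a' l| ≤ |a l| := by
        intro l
        rw [hprop, Pi.smul_apply, smul_eq_mul, abs_mul]
        exact mul_le_of_le_one_left (abs_nonneg _) hρ.le
      have h6 := sum_natAbs_lt_of_mulVec_eq A hA z z' hz0 _ hρ (by rw [← ha, ← ha']; exact hprop)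
      refine absurd (hmin z' hz0' ?_ fun i => ?_) (not_le.mpr h6)
      · rw [← ha']; exact (hle 0).trans hzS
      · rw [← ha']; exact (hle _).trans (hzi i)
    · rw [hcard, hprod]
      revert hkl
      refine Fin.cases (fun hkl => ?_) (fun i hkl => ?_) k
      · obtain ⟨i, rfl⟩ := Fin.exists_succ_eq.mpr hkl.symm
        exact hmixed i
      revert hkl
      refine Fin.cases (fun hkl => ?_) (fun j hkl => ?_) l
      · rw [hβ0, hβs, mul_comm η]
        convert hmixed i using 3
        rw [← abs_neg]
        congr 1
        ring
      · rw [hβs, hβs]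
        have h5 : |a i.succ * a' j.succ - a j.succ * a' i.succ| ≤ 2 * S ^ (-g) * (2 * c / η) := by
          calc _ ≤ |a i.succ * a' j.succ| + |a j.succ * a' i.succ| := abs_sub _ _
            _ = |a i.succ| * |a' j.succ| + |a j.succ| * |a' i.succ| := by rw [abs_mul, abs_mul]
            _ ≤ S ^ (-g) * (2 * c / η) + S ^ (-g) * (2 * c / η) := by
                gcongr
                · exact hzi i
                · exact (hzi' j).trans hq'
                · exact hzi j
                · exact (hzi' i).trans hq'
            _ = _ := by ring
        rw [inv_mul_eq_div, le_div_iff₀ hS]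
        calc _ ≤ c * (2 * S ^ (-g) * (2 * c / η) * (η * η)) * S := by gcongr
          _ = 4 * c ^ 2 * S ^ (1 - g) * η := by rw [hSg]; field_simp; ring
          _ ≤ η ^ n := by rw [hηn]; gcongr

/-! ### The matrix of the two systems -/

/-- The matrix of the linear forms `x₀`, `x₀ θ_i - x_i`; its transpose is the matrix of the forms
`x₀ + ∑ θ_i x_i`, `- x_i`. -/
noncomputable def formMatrix {n : ℕ} (θ : Fin n → ℝ) : Matrix (Fin (n + 1)) (Fin (n + 1)) ℝ :=
  Matrix.of (Fin.cons (Fin.cons 1 0) fun i => Fin.cons (θ i) (-Pi.single i 1))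

theorem formMatrix_mulVec_zero {n : ℕ} (θ : Fin n → ℝ) (v : Fin (n + 1) → ℝ) :
    (formMatrix θ).mulVec v 0 = v 0 := by
  simp [formMatrix, Matrix.mulVec, dotProduct, Fin.sum_univ_succ]

theorem formMatrix_mulVec_succ {n : ℕ} (θ : Fin n → ℝ) (v : Fin (n + 1) → ℝ) (i : Fin n) :
    (formMatrix θ).mulVec v i.succ = v 0 * θ i - v i.succ := by
  simp [formMatrix, Matrix.mulVec, dotProduct, Fin.sum_univ_succ, Pi.single_apply]
  ring

theorem formMatrix_transpose_mulVec_zero {n : ℕ} (θ : Fin n → ℝ) (v : Fin (n + 1) → ℝ) :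
    (formMatrix θ).transpose.mulVec v 0 = v 0 + ∑ i, θ i * v i.succ := by
  simp [formMatrix, Matrix.mulVec, dotProduct, Fin.sum_univ_succ]

theorem formMatrix_transpose_mulVec_succ {n : ℕ} (θ : Fin n → ℝ) (v : Fin (n + 1) → ℝ)
    (i : Fin n) : (formMatrix θ).transpose.mulVec v i.succ = -v i.succ := by
  simp [formMatrix, Matrix.mulVec, dotProduct, Fin.sum_univ_succ, Pi.single_apply]

theorem formMatrix_mul_self {n : ℕ} (θ : Fin n → ℝ) : formMatrix θ * formMatrix θ = 1 := by
  apply Matrix.mulVec_injective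
  funext v
  rw [← Matrix.mulVec_mulVec, Matrix.one_mulVec]
  funext k
  refine Fin.cases ?_ (fun i => ?_) k
  · rw [formMatrix_mulVec_zero, formMatrix_mulVec_zero]
  · rw [formMatrix_mulVec_succ, formMatrix_mulVec_zero, formMatrix_mulVec_succ]
    ring

theorem formMatrix_transpose_mul_self {n : ℕ} (θ : Fin n → ℝ) :
    (formMatrix θ).transpose * (formMatrix θ).transpose = 1 := by
  rw [← Matrix.transpose_mul, formMatrix_mul_self, Matrix.transpose_one]

theorem SimSolvable.exists_int {n : ℕ} {θ : Fin n → ℝ} {γ t : ℝ} (h : SimSolvable θ γ t) :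
    ∃ z : Fin (n + 1) → ℤ, z ≠ 0 ∧ |(formMatrix θ).mulVec (fun j => (z j : ℝ)) 0| ≤ t ∧
      ∀ i : Fin n, |(formMatrix θ).mulVec (fun j => (z j : ℝ)) i.succ| ≤ t ^ (-γ) := by
  obtain ⟨x₀, x, h1, h2, h3⟩ := h
  refine ⟨Fin.cons x₀ x, ?_, ?_, fun i => ?_⟩
  · intro h0
    have : x₀ = 0 := congrFun h0 0
    simp [this] at h2
  · simpa [formMatrix_mulVec_zero] using h3
  · simpa [formMatrix_mulVec_succ] using h1 i

/-- Were x₀ zero, each |x_i| would be at most t ^ (-γ) < 1 and z would vanish. This restores the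
condition 0 < |x₀|. -/
theorem simSolvable_of_int {n : ℕ} {θ : Fin n → ℝ} {γ t : ℝ} (ht : t ^ (-γ) < 1)
    {z : Fin (n + 1) → ℤ} (hz : z ≠ 0) (h0 : |(formMatrix θ).mulVec (fun j => (z j : ℝ)) 0| ≤ t)
    (h : ∀ i : Fin n, |(formMatrix θ).mulVec (fun j => (z j : ℝ)) i.succ| ≤ t ^ (-γ)) :
    SimSolvable θ γ t := by
  simp only [formMatrix_mulVec_zero, formMatrix_mulVec_succ] at h0 h
  refine ⟨z 0, fun i => z i.succ, h, ?_, h0⟩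
  by_contra! hneg
  have hz0 : z 0 = 0 := by
    have : (z 0 : ℝ) = 0 := abs_nonpos_iff.mp hneg
    exact_mod_cast this
  refine hz (funext fun k => ?_)
  refine Fin.cases hz0 (fun i => ?_) k
  have := (h i).trans_lt ht
  rw [hz0] at this
  simp only [Int.cast_zero, zero_mul, zero_sub, abs_neg] at this
  exact Int.abs_lt_one_iff.mp (by exact_mod_cast this)

theorem LinSolvable.exists_int {n : ℕ} {θ : Fin n → ℝ} {γ t : ℝ} (h : LinSolvable θ γ t) :
    ∃ w : Fin (n + 1) → ℤ, w ≠ 0 ∧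
      |(formMatrix θ).transpose.mulVec (fun j => (w j : ℝ)) 0| ≤ t ^ (-γ) ∧
      ∀ i : Fin n, |(formMatrix θ).transpose.mulVec (fun j => (w j : ℝ)) i.succ| ≤ t := by
  obtain ⟨x₀, x, h1, ⟨i, hi⟩, h3⟩ := h
  refine ⟨Fin.cons x₀ x, ?_, ?_, fun i => ?_⟩
  · intro h0
    have : x i = 0 := congrFun h0 i.succ
    simp [this] at hi
  · simpa [formMatrix_transpose_mulVec_zero] using h1
  · simpa [formMatrix_transpose_mulVec_succ] using h3 i

/-- Were all x_i zero, |x₀| ≤ t ^ (-γ) < 1 would make w vanish. -/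
theorem linSolvable_of_int {n : ℕ} {θ : Fin n → ℝ} {γ t : ℝ} (ht : t ^ (-γ) < 1)
    {w : Fin (n + 1) → ℤ} (hw : w ≠ 0)
    (h0 : |(formMatrix θ).transpose.mulVec (fun j => (w j : ℝ)) 0| ≤ t ^ (-γ))
    (h : ∀ i : Fin n, |(formMatrix θ).transpose.mulVec (fun j => (w j : ℝ)) i.succ| ≤ t) :
    LinSolvable θ γ t := by
  simp only [formMatrix_transpose_mulVec_zero, formMatrix_transpose_mulVec_succ, abs_neg] at h0 h
  refine ⟨w 0, fun i => w i.succ, h0, ?_, h⟩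
  by_contra! hneg
  have hw0 : ∀ i : Fin n, w i.succ = 0 := fun i => by
    have : (w i.succ : ℝ) = 0 := abs_nonpos_iff.mp (hneg i)
    exact_mod_cast this
  refine hw (funext fun k => ?_)
  refine Fin.cases ?_ hw0 k
  have := h0.trans_lt ht
  simp only [hw0, Int.cast_zero, mul_zero, Finset.sum_const_zero, add_zero] at this
  exact Int.abs_lt_one_iff.mp (by exact_mod_cast this)

theorem rpow_neg_lt_one {t γ : ℝ} (ht : 1 < t) (hγ : 0 < γ) : t ^ (-γ) < 1 :=
  Real.rpow_lt_one_of_one_lt_of_neg ht (by linarith)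

/-! ### Dirichlet's bounds -/

/-- Dirichlet's theorem for simultaneous approximation. -/
theorem simSolvable_of_mul_lt_one {n : ℕ} (θ : Fin n → ℝ) {γ : ℝ} (hγ : 0 < γ) (h : n * γ < 1) :
    ∀ᶠ t : ℝ in atTop, SimSolvable θ γ t := by
  filter_upwards [eventually_gt_atTop 1] with t ht
  have ht0 : 0 < t := by linarith
  have hd := abs_det_eq_one_of_mul_self _ (formMatrix_mul_self θ)
  obtain ⟨z, hz, hlt⟩ := exists_int_mulVec_lt (formMatrix θ)
    (fun h0 => by rw [h0] at hd; simp at hd)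
    (Fin.cons t fun _ => t ^ (-γ))
    (fun i => by
      refine Fin.cases ht0 (fun i => ?_) i
      exact Real.rpow_pos_of_pos ht0 _)
    (by
      rw [hd, Fin.prod_univ_succ]
      simp only [Fin.cons_zero, Fin.cons_succ, Finset.prod_const, Finset.card_univ,
        Fintype.card_fin]
      rw [← Real.rpow_natCast, ← Real.rpow_mul ht0.le]
      nth_rewrite 1 [← Real.rpow_one t]
      rw [← Real.rpow_add ht0]
      exact Real.one_lt_rpow ht (by linarith))
  exact simSolvable_of_int (rpow_neg_lt_one ht hγ) hz (hlt 0).le fun i => (hlt i.succ).le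

/-- Dirichlet's theorem for a linear form. -/
theorem linSolvable_of_lt {n : ℕ} (θ : Fin n → ℝ) {γ : ℝ} (hγ : 0 < γ) (h : γ < n) :
    ∀ᶠ t : ℝ in atTop, LinSolvable θ γ t := by
  filter_upwards [eventually_gt_atTop 1] with t ht
  have ht0 : 0 < t := by linarith
  have hd := abs_det_eq_one_of_mul_self _ (formMatrix_transpose_mul_self θ)
  obtain ⟨z, hz, hlt⟩ := exists_int_mulVec_lt (formMatrix θ).transpose
    (fun h0 => by rw [h0] at hd; simp at hd)
    (Fin.cons (t ^ (-γ)) fun _ => t)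
    (fun i => by
      refine Fin.cases ?_ (fun i => ht0) i
      exact Real.rpow_pos_of_pos ht0 _)
    (by
      rw [hd, Fin.prod_univ_succ]
      simp only [Fin.cons_zero, Fin.cons_succ, Finset.prod_const, Finset.card_univ,
        Fintype.card_fin]
      rw [← Real.rpow_natCast, ← Real.rpow_add ht0]
      exact Real.one_lt_rpow ht (by linarith))
  exact linSolvable_of_int (rpow_neg_lt_one ht hγ) hz (hlt 0).le fun i => (hlt i.succ).le

/-! ### Transference between uniform exponents -/

/-- Transference of uniform exponents, from simultaneous approximation to the linear form. -/
theorem eventually_linSolvable_of_sim {n : ℕ} (hn : 1 ≤ n) (θ : Fin n → ℝ) {γ δ : ℝ}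
    (hγn : 1 ≤ n * γ) (hγ1 : γ < 1) (hδ : 0 < δ) (hδγ : δ * (1 - γ) < n - 1)
    (h : ∀ᶠ t : ℝ in atTop, SimSolvable θ γ t) : ∀ᶠ s : ℝ in atTop, LinSolvable θ δ s := by
  obtain ⟨t₀, ht₀⟩ := eventually_atTop.mp h
  have hγ0 : 0 < γ := by
    have : (0 : ℝ) < n := by exact_mod_cast hn
    exact pos_of_mul_pos_right (zero_lt_one.trans_le hγn) this.le
  set c : ℝ := ((n + 1 : ℕ) : ℝ) ^ (n + 1) with hc
  have hc0 : 0 < c := by positivity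
  filter_upwards [eventually_gt_atTop 1, (tendsto_rpow_atTop hδ).eventually_ge_atTop t₀,
    (tendsto_pow_atTop (α := ℝ) (n := n) (by omega)).eventually_ge_atTop (t₀ * (2 * c)),
    (tendsto_rpow_atTop (y := (n - 1) - δ * (1 - γ)) (by linarith)).eventually_ge_atTop
      (4 * c ^ 2)] with s hs1 hs2 hs3 hs4
  have hs0 : 0 < s := by linarith
  -- The box has S = s ^ δ and η = s > 1, so n γ ≥ 1 yields η ≤ η ^ (n γ).
  obtain ⟨w, hw, hw0, hwi⟩ := exists_int_dual_of_family hn (formMatrix θ) (formMatrix_mul_self θ)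
    (s ^ δ) s γ c (Real.rpow_pos_of_pos hs0 _) hs0 hγ0 hγ1 hc
    (fun r hr _ => by
      refine (ht₀ r (le_trans (le_min hs2 ?_) hr)).exists_int
      rwa [le_div_iff₀ (by positivity)])
    (by
      rw [← Real.rpow_mul hs0.le]
      calc 4 * c ^ 2 * s ^ (δ * (1 - γ))
          ≤ s ^ ((n - 1) - δ * (1 - γ)) * s ^ (δ * (1 - γ)) := by gcongr
        _ = s ^ ((n : ℝ) - 1) := by rw [← Real.rpow_add hs0]; congr 1; ring
        _ = s ^ (n - 1) := by rw [← Real.rpow_natCast, Nat.cast_sub hn, Nat.cast_one])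
    (by
      calc s = s ^ (1 : ℝ) := (Real.rpow_one s).symm
        _ ≤ s ^ ((n : ℝ) * γ) := Real.rpow_le_rpow_of_exponent_le hs1.le hγn)
  rw [← Real.rpow_neg hs0.le] at hw0
  exact linSolvable_of_int (rpow_neg_lt_one hs1 hδ) hw hw0 hwi

/-- Transference of uniform exponents, from the linear form to simultaneous approximation. -/
theorem eventually_simSolvable_of_lin {n : ℕ} (hn : 1 ≤ n) (θ : Fin n → ℝ) {γ δ : ℝ}
    (hγn : n ≤ γ) (hγ1 : 1 < γ) (hδ : 0 < δ) (hδγ : δ * (n - 1) < 1 - γ⁻¹)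
    (h : ∀ᶠ t : ℝ in atTop, LinSolvable θ γ t) : ∀ᶠ s : ℝ in atTop, SimSolvable θ δ s := by
  obtain ⟨t₀, ht₀⟩ := eventually_atTop.mp h
  have hγ0 : 0 < γ := by linarith
  set c : ℝ := ((n + 1 : ℕ) : ℝ) ^ (n + 1) with hc
  have hc0 : 0 < c := by positivity
  filter_upwards [eventually_gt_atTop 1,
    (tendsto_rpow_atTop (inv_pos.mpr hγ0)).eventually_ge_atTop t₀,
    (tendsto_rpow_atTop (y := (1 - γ⁻¹) - δ * (n - 1)) (by linarith)).eventually_ge_atTop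
      (4 * c ^ 2)] with s hs1 hs2 hs4
  have hs0 : 0 < s := by linarith
  have hη : 0 < s ^ (-δ) := Real.rpow_pos_of_pos hs0 _
  -- The roles are reversed by r = t ^ (-γ): r ≤ 1/s means t ≥ s ^ (1/γ), hence t is large. Here η =
  -- s ^ (-δ) < 1, so γ ≥ n yields η ≤ η ^ (n / γ).
  obtain ⟨w, hw, hw0, hwi⟩ := exists_int_dual_of_family hn (formMatrix θ).transpose
    (formMatrix_transpose_mul_self θ)
    s⁻¹ (s ^ (-δ)) γ⁻¹ c (inv_pos.mpr hs0) hη (inv_pos.mpr hγ0) (inv_lt_one_of_one_lt₀ hγ1) hc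
    (fun r hr hr' => by
      have hr0 : 0 < r := lt_of_lt_of_le (by positivity) hr
      have h1 : t₀ ≤ r ^ (-γ⁻¹) := by
        refine hs2.trans ?_
        rw [Real.rpow_neg hr0.le, ← Real.inv_rpow hr0.le]
        refine Real.rpow_le_rpow hs0.le ?_ (inv_pos.mpr hγ0).le
        rwa [le_inv_comm₀ hs0 hr0]
      have h2 := (ht₀ _ h1).exists_int
      rwa [← Real.rpow_mul hr0.le, neg_mul_neg, inv_mul_cancel₀ hγ0.ne', Real.rpow_one] at h2)
    (by
      rw [Real.inv_rpow hs0.le, ← Real.rpow_neg hs0.le, ← Real.rpow_natCast _ (n - 1),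
        ← Real.rpow_mul hs0.le]
      calc 4 * c ^ 2 * s ^ (-(1 - γ⁻¹))
          ≤ s ^ ((1 - γ⁻¹) - δ * (n - 1)) * s ^ (-(1 - γ⁻¹)) := by gcongr
        _ = s ^ (-δ * ((n - 1 : ℕ) : ℝ)) := by
            rw [← Real.rpow_add hs0, Nat.cast_sub hn, Nat.cast_one]; congr 1; ring)
    (by
      calc s ^ (-δ) = (s ^ (-δ)) ^ (1 : ℝ) := (Real.rpow_one _).symm
        _ ≤ (s ^ (-δ)) ^ ((n : ℝ) * γ⁻¹) := by
          refine Real.rpow_le_rpow_of_exponent_ge hη (rpow_neg_lt_one hs1 hδ).le ?_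
          rw [← div_eq_mul_inv, div_le_one hγ0]
          exact hγn)
  rw [inv_inv, Matrix.transpose_transpose] at hw0
  rw [Matrix.transpose_transpose] at hwi
  exact simSolvable_of_int (rpow_neg_lt_one hs1 hδ) hw hw0 hwi

/-! ### Regular exponents through a vanishing pairing -/

theorem linForm_ne_zero {n : ℕ} {θ : Fin n → ℝ}
    (hθ : LinearIndependent ℚ (Fin.cons 1 θ : Fin (n + 1) → ℝ)) (y₀ : ℤ) (y : Fin n → ℤ)
    (i : Fin n) (hi : y i ≠ 0) : (y₀ : ℝ) + ∑ i, θ i * (y i : ℝ) ≠ 0 := by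
  intro h0
  have h := Fintype.linearIndependent_iff.mp hθ (Fin.cons (y₀ : ℚ) fun i => (y i : ℚ)) (by
    rw [Fin.sum_univ_succ]
    simp only [Fin.cons_zero, Fin.cons_succ, Rat.smul_def, Rat.cast_intCast, mul_one]
    rw [← h0]
    congr 1
    exact Finset.sum_congr rfl fun i _ => mul_comm _ _) i.succ
  simp only [Fin.cons_succ] at h
  exact hi (by exact_mod_cast h)

theorem mul_sub_ne_zero {n : ℕ} {θ : Fin n → ℝ}
    (hθ : LinearIndependent ℚ (Fin.cons 1 θ : Fin (n + 1) → ℝ)) (i : Fin n) (m k : ℤ)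
    (hm : m ≠ 0) : (m : ℝ) * θ i - k ≠ 0 := by
  have h := linForm_ne_zero hθ (-k) (Pi.single i m) i (by simpa using hm)
  intro h0
  apply h
  rw [Finset.sum_eq_single i (fun j _ hj => by simp [hj]) (by simp)]
  simp only [Pi.single_eq_same]
  push_cast
  linarith

/-- If the pairing of an approximation point with a linear form is small, it vanishes, and the
linear form is bounded in terms of the approximation. -/
theorem abs_mul_linForm_le {n : ℕ} (θ : Fin n → ℝ) (x₀ y₀ : ℤ) (x y : Fin n → ℤ) {L Y : ℝ}
    (hL : ∀ i, |(x₀ : ℝ) * θ i - x i| ≤ L) (hY : ∀ i, |(y i : ℝ)| ≤ Y)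
    (h : |(x₀ : ℝ)| * |(y₀ : ℝ) + ∑ i, θ i * (y i : ℝ)| + n * (Y * L) < 1) :
    |(x₀ : ℝ)| * |(y₀ : ℝ) + ∑ i, θ i * (y i : ℝ)| ≤ n * (Y * L) := by
  have hsum : |∑ i, (y i : ℝ) * ((x₀ : ℝ) * θ i - x i)| ≤ n * (Y * L) := by
    refine (Finset.abs_sum_le_sum_abs _ _).trans ?_
    calc ∑ i, |(y i : ℝ) * ((x₀ : ℝ) * θ i - x i)| ≤ ∑ _i : Fin n, Y * L := by
          refine Finset.sum_le_sum fun i _ => ?_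
          rw [abs_mul]
          exact mul_le_mul (hY i) (hL i) (abs_nonneg _) ((abs_nonneg _).trans (hY i))
      _ = n * (Y * L) := by simp
  have hid : (x₀ : ℝ) * ((y₀ : ℝ) + ∑ i, θ i * (y i : ℝ))
      - ∑ i, (y i : ℝ) * ((x₀ : ℝ) * θ i - x i) = ((x₀ * y₀ + ∑ i, x i * y i : ℤ) : ℝ) := by
    push_cast
    rw [mul_add, add_sub_assoc, Finset.mul_sum, ← Finset.sum_sub_distrib]
    congr 1
    exact Finset.sum_congr rfl fun i _ => by ring
  have hlt : |((x₀ * y₀ + ∑ i, x i * y i : ℤ) : ℝ)| < 1 := by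
    rw [← hid]
    refine (abs_sub _ _).trans_lt ?_
    rw [abs_mul]
    linarith
  have h0 : x₀ * y₀ + ∑ i, x i * y i = 0 := Int.abs_lt_one_iff.mp (by exact_mod_cast hlt)
  rw [h0, Int.cast_zero, sub_eq_zero] at hid
  rw [← abs_mul, hid]
  exact hsum

/-- Good simultaneous approximations occur with arbitrarily large denominators. -/
theorem exists_large_sim {n : ℕ} (hn : 1 ≤ n) {θ : Fin n → ℝ}
    (hθ : LinearIndependent ℚ (Fin.cons 1 θ : Fin (n + 1) → ℝ)) {v : ℝ} (hv0 : 0 < v)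
    (hv : ∃ᶠ t : ℝ in atTop, SimSolvable θ v t) (K : ℝ) :
    ∃ (x₀ : ℤ) (x : Fin n → ℤ), K < |(x₀ : ℝ)| ∧ 0 < |(x₀ : ℝ)| ∧
      ∀ i, |(x₀ : ℝ) * θ i - x i| ≤ |(x₀ : ℝ)| ^ (-v) := by
  let i₀ : Fin n := ⟨0, hn⟩
  let s : Finset ℤ := (Finset.Icc (-⌊K⌋) ⌊K⌋).erase 0
  -- Each of the finitely many nonzero denominators up to K keeps a positive distance from the
  -- integers at the coordinate i₀, so large t excludes them all.
  have hev : ∀ᶠ t : ℝ in atTop, ∀ m ∈ s, t ^ (-v) < |(m : ℝ) * θ i₀ - round ((m : ℝ) * θ i₀)| := by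
    rw [eventually_all_finset]
    intro m hm
    have hpos := abs_pos.mpr
      (mul_sub_ne_zero hθ i₀ m (round ((m : ℝ) * θ i₀)) (Finset.ne_of_mem_erase hm))
    exact (tendsto_rpow_neg_atTop hv0).eventually_lt_const hpos
  obtain ⟨t, ⟨x₀, x, h1, h2, h3⟩, hm⟩ := (hv.and_eventually hev).exists
  refine ⟨x₀, x, ?_, h2, fun i => (h1 i).trans
    (Real.rpow_le_rpow_of_nonpos h2 h3 (by linarith))⟩
  by_contra! hle
  have hx0 : x₀ ≠ 0 := by
    rintro rfl
    simp at h2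
  have hmem : x₀ ∈ s := by
    refine Finset.mem_erase.mpr ⟨hx0, Finset.mem_Icc.mpr (abs_le.mp ?_)⟩
    exact Int.le_floor.mpr (by exact_mod_cast hle)
  exact absurd (hm x₀ hmem) (not_lt.mpr ((round_le _ _).trans (h1 i₀)))

/-- The regular exponent of the linear form in terms of its uniform exponent and the regular
exponent of simultaneous approximation. -/
theorem frequently_linSolvable {n : ℕ} (hn : 1 ≤ n) {θ : Fin n → ℝ}
    (hθ : LinearIndependent ℚ (Fin.cons 1 θ : Fin (n + 1) → ℝ)) {u v w : ℝ} (hu0 : 0 < u)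
    (hv0 : 0 < v) (huv : 1 < u * v) (hw : w < u * (1 + v) - 1)
    (hu : ∀ᶠ t : ℝ in atTop, LinSolvable θ u t) (hv : ∃ᶠ t : ℝ in atTop, SimSolvable θ v t) :
    ∃ᶠ t : ℝ in atTop, LinSolvable θ w t := by
  -- The linear form is taken at height X ^ e. The conditions e > 1/u and e < v make both terms
  -- bounding the pairing tend to zero, and e (1 + w) < 1 + v turns the resulting bound n X ^ (e - v
  -- - 1) into X ^ (-e w). All hold just above 1/u.
  obtain ⟨e, ⟨he1, he2⟩, he3⟩ : ∃ e : ℝ, (e < v ∧ e * (1 + w) < 1 + v) ∧ u⁻¹ < e := by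
    have h1 : ∀ᶠ e in nhds u⁻¹, e < v :=
      eventually_lt_nhds (by rwa [inv_lt_iff_one_lt_mul₀' hu0])
    have h2 : ∀ᶠ e in nhds u⁻¹, e * (1 + w) < 1 + v := by
      refine (by fun_prop : Continuous fun e : ℝ => e * (1 + w)).continuousAt.eventually_lt_const ?_
      rw [inv_mul_lt_iff₀ hu0]
      linarith
    exact (((h1.and h2).filter_mono nhdsWithin_le_nhds).and
      (self_mem_nhdsWithin (s := Set.Ioi u⁻¹))).exists
  have he0 : 0 < e := (inv_pos.mpr hu0).trans he3
  have hue : 1 < e * u := by rwa [← inv_lt_iff_one_lt_mul₀ hu0]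
  rw [frequently_atTop]
  intro a
  have h1 := (tendsto_rpow_atTop he0).eventually (hu.and (eventually_ge_atTop a))
  have h2 := (tendsto_rpow_neg_atTop (y := e * u - 1) (by linarith)).eventually_lt_const
    (show (0 : ℝ) < 1 / 2 by norm_num)
  have hn0 : (0 : ℝ) < n := by exact_mod_cast hn
  have h3 := (tendsto_rpow_neg_atTop (y := v - e) (by linarith)).eventually_lt_const
    (show (0 : ℝ) < 1 / (2 * n) by positivity)
  have h4 := (tendsto_rpow_neg_atTop (y := 1 + v - e * (1 + w)) (by linarith)).eventually_lt_const
    (show (0 : ℝ) < 1 / n by positivity)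
  obtain ⟨K, hK⟩ := eventually_atTop.mp (h1.and (h2.and (h3.and h4)))
  obtain ⟨x₀, x, hxK, hx0, hx⟩ := exists_large_sim hn hθ hv0 hv K
  set X := |(x₀ : ℝ)| with hX
  obtain ⟨⟨⟨y₀, y, hy1, hy2, hy3⟩, ha⟩, h2, h3, h4⟩ := hK X hxK.le
  refine ⟨X ^ e, ha, y₀, y, ?_, hy2, hy3⟩
  rw [← Real.rpow_mul hx0.le] at hy1 ⊢
  have hpair := abs_mul_linForm_le θ x₀ y₀ x y hx hy3 (by
    rw [← hX]
    have e1 : X * X ^ (e * -u) = X ^ (-(e * u - 1)) := by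
      nth_rewrite 1 [← Real.rpow_one X]
      rw [← Real.rpow_add hx0]
      congr 1
      ring
    have e2 : X ^ e * X ^ (-v) = X ^ (-(v - e)) := by
      rw [← Real.rpow_add hx0]
      congr 1
      ring
    have e3 : X * |(y₀ : ℝ) + ∑ i, θ i * (y i : ℝ)| ≤ X ^ (-(e * u - 1)) := by
      rw [← e1]; gcongr
    have e4 : n * (X ^ e * X ^ (-v)) < 1 / 2 := by
      rw [e2]
      calc n * X ^ (-(v - e)) < n * (1 / (2 * n)) := by gcongr
        _ = 1 / 2 := by field_simp
    linarith)
  rw [← hX] at hpair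
  refine le_of_mul_le_mul_left (hpair.trans ?_) hx0
  have e5 : X ^ e * X ^ (-v) = X ^ (-(1 + v - e * (1 + w))) * (X * X ^ (e * -w)) := by
    nth_rewrite 4 [← Real.rpow_one X]
    rw [← Real.rpow_add hx0, ← Real.rpow_add hx0, ← Real.rpow_add hx0]
    congr 1
    ring
  rw [e5, ← mul_assoc]
  have e6 : n * X ^ (-(1 + v - e * (1 + w))) ≤ 1 := by
    rw [← le_div_iff₀' hn0]; exact h4.le
  exact mul_le_of_le_one_left (by positivity) e6

theorem tendsto_rpow_nhdsGT_zero {a : ℝ} (ha : 0 < a) :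
    Tendsto (fun m : ℝ => m ^ a) (nhdsWithin 0 (Set.Ioi 0)) (nhds 0) := by
  have h := (Real.continuousAt_rpow_const 0 a (Or.inr ha.le)).tendsto
  rw [Real.zero_rpow ha.ne'] at h
  exact h.mono_left nhdsWithin_le_nhds

/-- Small values of the linear form produce simultaneous approximations with a bounded
denominator. -/
theorem frequently_exists_sim {n : ℕ} (hn : 1 ≤ n) {θ : Fin n → ℝ}
    (hθ : LinearIndependent ℚ (Fin.cons 1 θ : Fin (n + 1) → ℝ)) {w l : ℝ} (hw0 : 0 < w)
    (hwl : w⁻¹ < l)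
    (hw : ∃ᶠ t : ℝ in atTop, LinSolvable θ w t) (hl : ∀ᶠ t : ℝ in atTop, SimSolvable θ l t) :
    ∃ᶠ m in nhdsWithin (0 : ℝ) (Set.Ioi 0), ∃ (x₀ : ℤ) (x : Fin n → ℤ), 0 < |(x₀ : ℝ)| ∧
      |(x₀ : ℝ)| ≤ n * 4 ^ l * m ^ (l - w⁻¹ - 1) ∧
      ∀ i, |(x₀ : ℝ) * θ i - x i| ≤ (4 * m) ^ l := by
  have hn0 : (0 : ℝ) < n := by exact_mod_cast hn
  have hl0 : 0 < l := (inv_pos.mpr hw0).trans hwl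
  rw [Filter.Frequently]
  intro hcon
  -- The parameter 1 / (4 m) gives |x₀| m ≤ 1/4; the other part of the pairing is made less than 1/2
  -- by `h2`.
  have h1 : ∀ᶠ m in nhdsWithin (0 : ℝ) (Set.Ioi 0), SimSolvable θ l (4⁻¹ * m⁻¹) :=
    (tendsto_inv_nhdsGT_zero.const_mul_atTop (by norm_num : (0 : ℝ) < 4⁻¹)).eventually hl
  have h2 := (tendsto_rpow_nhdsGT_zero (a := l - w⁻¹) (by linarith)).eventually_lt_const
    (show (0 : ℝ) < 1 / (2 * (n * 4 ^ l)) by positivity)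
  obtain ⟨ε, hε, hsub⟩ := mem_nhdsGT_iff_exists_Ioo_subset.mp (hcon.and (h1.and h2))
  have hε0 : 0 < ε := hε
  obtain ⟨t, ⟨⟨y₀, y, hy1, ⟨i, hi⟩, hy3⟩, ht0⟩, htε⟩ := ((hw.and_eventually
    (eventually_gt_atTop 0)).and_eventually
    ((tendsto_rpow_neg_atTop hw0).eventually_lt_const hε0)).exists
  set m := |(y₀ : ℝ) + ∑ i, θ i * (y i : ℝ)| with hm
  have hm0 : 0 < m := abs_pos.mpr (linForm_ne_zero hθ y₀ y i (by
    rintro h0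
    simp [h0] at hi))
  obtain ⟨hcon, ⟨x₀, x, hx1, hx2, hx3⟩, h2⟩ := hsub ⟨hm0, hy1.trans_lt htε⟩
  rw [← mul_inv] at hx1 hx3
  have e0 : ((4 * m)⁻¹) ^ (-l) = (4 * m) ^ l := by
    rw [Real.inv_rpow (by positivity), ← Real.rpow_neg (by positivity), neg_neg]
  rw [e0] at hx1
  have hY : ∀ i, |(y i : ℝ)| ≤ m ^ (-w⁻¹) := by
    intro i
    refine (hy3 i).trans ?_
    calc t = (t ^ (-w)) ^ (-w⁻¹) := by
          rw [← Real.rpow_mul ht0.le, neg_mul_neg, mul_inv_cancel₀ hw0.ne', Real.rpow_one]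
      _ ≤ m ^ (-w⁻¹) := Real.rpow_le_rpow_of_nonpos hm0 hy1 (by
          have := inv_pos.mpr hw0
          linarith)
  have e1 : n * (m ^ (-w⁻¹) * (4 * m) ^ l) = n * 4 ^ l * m ^ (l - w⁻¹) := by
    rw [Real.mul_rpow (by norm_num) hm0.le, sub_eq_add_neg, Real.rpow_add hm0]
    ring
  have hpair := abs_mul_linForm_le θ x₀ y₀ x y hx1 hY (by
    rw [← hm, e1]
    have e2 : |(x₀ : ℝ)| * m ≤ 1 / 4 := by
      calc |(x₀ : ℝ)| * m ≤ (4 * m)⁻¹ * m := by gcongr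
        _ = 1 / 4 := by field_simp
    have e3 : n * 4 ^ l * m ^ (l - w⁻¹) < 1 / 2 := by
      calc n * 4 ^ l * m ^ (l - w⁻¹) < n * 4 ^ l * (1 / (2 * (n * 4 ^ l))) := by gcongr
        _ = 1 / 2 := by field_simp
    linarith)
  rw [← hm, e1] at hpair
  refine hcon ⟨x₀, x, hx2, ?_, hx1⟩
  rw [Real.rpow_sub_one hm0.ne', ← mul_div_assoc, le_div_iff₀ hm0]
  exact hpair

/-- Beyond this bound the power of m in `frequently_exists_sim` has a positive exponent, so a
nonzero integer x₀ would be smaller than one. -/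
theorem uniform_sim_le {n : ℕ} (hn : 1 ≤ n) {θ : Fin n → ℝ}
    (hθ : LinearIndependent ℚ (Fin.cons 1 θ : Fin (n + 1) → ℝ)) {w l : ℝ} (hw0 : 0 < w)
    (hwl : w⁻¹ < l)
    (hw : ∃ᶠ t : ℝ in atTop, LinSolvable θ w t) (hl : ∀ᶠ t : ℝ in atTop, SimSolvable θ l t) :
    l ≤ 1 + w⁻¹ := by
  by_contra! hlt
  have hn0 : (0 : ℝ) < n := by exact_mod_cast hn
  have h1 := (tendsto_rpow_nhdsGT_zero (a := l - w⁻¹ - 1) (by linarith)).eventually_lt_const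
    (show (0 : ℝ) < 1 / (n * 4 ^ l) by positivity)
  obtain ⟨m, ⟨x₀, x, hx1, hx2, -⟩, hm⟩ :=
    ((frequently_exists_sim hn hθ hw0 hwl hw hl).and_eventually h1).exists
  have h2 : |(x₀ : ℝ)| < 1 := by
    refine hx2.trans_lt ?_
    calc n * 4 ^ l * m ^ (l - w⁻¹ - 1) < n * 4 ^ l * (1 / (n * 4 ^ l)) := by gcongr
      _ = 1 := by field_simp
  have h3 : x₀ = 0 := Int.abs_lt_one_iff.mp (by exact_mod_cast h2)
  simp [h3] at hx1

/-- The regular exponent of simultaneous approximation in terms of its uniform exponent and the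
regular exponent of the linear form. -/
theorem frequently_simSolvable {n : ℕ} (hn : 1 ≤ n) {θ : Fin n → ℝ}
    (hθ : LinearIndependent ℚ (Fin.cons 1 θ : Fin (n + 1) → ℝ)) {w l v : ℝ} (hw0 : 0 < w)
    (hwl : w⁻¹ < l) (hv0 : 0 < v) (hv : v * (1 + w⁻¹ - l) < l)
    (hw : ∃ᶠ t : ℝ in atTop, LinSolvable θ w t) (hl : ∀ᶠ t : ℝ in atTop, SimSolvable θ l t) :
    ∃ᶠ t : ℝ in atTop, SimSolvable θ v t := by
  have hn0 : (0 : ℝ) < n := by exact_mod_cast hn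
  have hl0 : 0 < l := (inv_pos.mpr hw0).trans hwl
  -- The approximation is read at height m ^ (-q): q > 1 + 1/w - l accommodates the denominator and
  -- q v < l the errors.
  obtain ⟨q, hq1, hq2⟩ := exists_between (a₁ := 1 + w⁻¹ - l) (a₂ := l / v)
    (by rwa [lt_div_iff₀' hv0])
  have hq0 : 0 < q := by linarith [uniform_sim_le hn hθ hw0 hwl hw hl]
  rw [lt_div_iff₀ hv0] at hq2
  rw [frequently_atTop]
  intro a
  have h1 := ((tendsto_rpow_atTop hq0).comp tendsto_inv_nhdsGT_zero).eventually_ge_atTop a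
  have h2 := (tendsto_rpow_nhdsGT_zero (a := q + l - w⁻¹ - 1) (by linarith)).eventually_lt_const
    (show (0 : ℝ) < 1 / (n * 4 ^ l) by positivity)
  have h3 := (tendsto_rpow_nhdsGT_zero (a := l - q * v) (by linarith)).eventually_lt_const
    (show (0 : ℝ) < 1 / 4 ^ l by positivity)
  have h4 : ∀ᶠ m in nhdsWithin (0 : ℝ) (Set.Ioi 0), 0 < m := self_mem_nhdsWithin
  obtain ⟨m, ⟨x₀, x, hx1, hx2, hx3⟩, h1, h2, h3, hm0⟩ :=
    ((frequently_exists_sim hn hθ hw0 hwl hw hl).and_eventually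
      (h1.and (h2.and (h3.and h4)))).exists
  have e0 : (m⁻¹) ^ q = m ^ (-q) := by rw [Real.inv_rpow hm0.le, Real.rpow_neg hm0.le]
  refine ⟨(m⁻¹) ^ q, h1, x₀, x, fun i => (hx3 i).trans ?_, hx1, hx2.trans ?_⟩
  · rw [e0, ← Real.rpow_mul hm0.le, neg_mul_neg, Real.mul_rpow (by norm_num) hm0.le]
    calc 4 ^ l * m ^ l = 4 ^ l * m ^ (l - q * v) * m ^ (q * v) := by
          rw [mul_assoc, ← Real.rpow_add hm0]
          congr 2
          ring
      _ ≤ 4 ^ l * (1 / 4 ^ l) * m ^ (q * v) := by gcongr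
      _ = m ^ (q * v) := by field_simp
  · rw [e0]
    calc (n : ℝ) * 4 ^ l * m ^ (l - w⁻¹ - 1)
        = n * 4 ^ l * m ^ (q + l - w⁻¹ - 1) * m ^ (-q) := by
          rw [mul_assoc ((n : ℝ) * 4 ^ l), ← Real.rpow_add hm0]
          congr 2
          ring
      _ ≤ n * 4 ^ l * (1 / (n * 4 ^ l)) * m ^ (-q) := by gcongr
      _ = m ^ (-q) := by field_simp

/-! ### Passage to the limit in the extended reals -/

theorem extQuot_coe {x y : ℝ} (hy : y ≠ 0) :
    extQuot (x : EReal) (y : EReal) = ((x / y : ℝ) : EReal) := by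
  rw [extQuot, if_neg, EReal.coe_div]
  rintro (h | h)
  · exact hy (by exact_mod_cast h)
  · exact EReal.coe_ne_top _ h

theorem extQuot_zero (a : EReal) : extQuot a 0 = ⊤ := by simp [extQuot]

theorem extQuot_top (b : EReal) : extQuot ⊤ b = ⊤ := by simp [extQuot]

/-- The inverse of a positive extended real is a real number. -/
theorem exists_inv_eq_coe {b : EReal} (hb : 0 < b) :
    ∃ β : ℝ, b⁻¹ = (β : EReal) ∧ 0 ≤ β ∧ (β ≠ 0 → b = ((β⁻¹ : ℝ) : EReal)) ∧
      ∀ β', β < β' → ((β'⁻¹ : ℝ) : EReal) < b := by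
  induction b with
  | bot => simp at hb
  | top => exact ⟨0, by simp, le_rfl, fun h => absurd rfl h,
      fun β' _ => EReal.coe_lt_top _⟩
  | coe x =>
    have hx : 0 < x := by exact_mod_cast hb
    refine ⟨x⁻¹, (EReal.coe_inv x), (inv_pos.mpr hx).le, fun _ => by rw [inv_inv],
      fun β' h => ?_⟩
    rw [EReal.coe_lt_coe_iff]
    exact inv_lt_of_inv_lt₀ hx h

/-- The restriction 1 < u v is harmless: if a c ≤ 1, then a (1 + c) ≤ a + 1 ≤ b + 1 already. -/
theorem le_extQuot_of_regular {a b c : EReal} (ha : 0 < a) (hab : a ≤ b) (hc : 0 < c)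
    (h : ∀ u v : ℝ, 0 < u → 0 < v → (u : EReal) < a → (v : EReal) < c → 1 < u * v →
      ((u * (1 + v) - 1 : ℝ) : EReal) ≤ b) :
    a ≤ extQuot (1 + b) (1 + c) := by
  induction b with
  | bot => exact absurd (ha.trans_le hab) (by simp)
  | top => rw [EReal.add_top_of_ne_bot (x := 1) (EReal.coe_ne_bot 1), extQuot_top]; exact le_top
  | coe b =>
  induction a with
  | bot => exact absurd ha (by simp)
  | top => exact absurd hab (by simp)
  | coe a =>
  have ha0 : 0 < a := by exact_mod_cast ha
  have hab' : a ≤ b := by exact_mod_cast hab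
  induction c with
  | bot => exact absurd hc (by simp)
  | top =>
    exfalso
    -- For finite b an infinite c is impossible: with u = a/2 this v gives u (1 + v) - 1 = a/2 + b +
    -- 1 > b.
    have hv : 0 < (b + 2) * (2 / a) := by have := ha0.trans_le hab'; positivity
    have e1 : a / 2 * ((b + 2) * (2 / a)) = b + 2 := by field_simp
    have h1 := h (a / 2) ((b + 2) * (2 / a)) (by linarith) hv
      (by exact_mod_cast half_lt_self ha0) (EReal.coe_lt_top _) (by linarith)
    have h2 : a / 2 * (1 + (b + 2) * (2 / a)) - 1 ≤ b := by exact_mod_cast h1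
    rw [mul_add, e1] at h2
    linarith
  | coe c =>
  have hc0 : 0 < c := by exact_mod_cast hc
  have e1 : (1 : EReal) + (b : EReal) = ((1 + b : ℝ) : EReal) := by push_cast; rfl
  have e2 : (1 : EReal) + (c : EReal) = ((1 + c : ℝ) : EReal) := by push_cast; rfl
  rw [e1, e2, extQuot_coe (by linarith), EReal.coe_le_coe_iff, le_div_iff₀ (by linarith)]
  by_contra! hlt
  have hac : 1 < a * c := by linarith
  have k1 : ∀ᶠ ε in nhds (0 : ℝ), 1 < (a - ε) * (c - ε) :=
    (by fun_prop : Continuous fun ε : ℝ => (a - ε) * (c - ε)).continuousAt.eventually_const_lt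
      (by simpa using hac)
  have k2 : ∀ᶠ ε in nhds (0 : ℝ), 1 + b < (a - ε) * (1 + (c - ε)) :=
    (by fun_prop : Continuous fun ε : ℝ => (a - ε) * (1 + (c - ε))).continuousAt.eventually_const_lt
      (by simpa using hlt)
  have k3 := (eventually_lt_nhds ha0).and (eventually_lt_nhds hc0)
  obtain ⟨ε, ⟨k1, k2, k3, k4⟩, hε⟩ := (((k1.and (k2.and k3)).filter_mono
    (nhdsWithin_le_nhds (s := Set.Ioi 0))).and self_mem_nhdsWithin).exists
  have hε0 : 0 < ε := hε
  have h1 := h (a - ε) (c - ε) (by linarith) (by linarith)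
    (by exact_mod_cast (by linarith : a - ε < a)) (by exact_mod_cast (by linarith : c - ε < c)) k1
  have h2 : (a - ε) * (1 + (c - ε)) - 1 ≤ b := by exact_mod_cast h1
  linarith

/-- Numbers up to n are below a by `ha`. A larger z with z (1 - c) < n - 1 forces c > 1/n, which
leaves room for γ between 1/n and c. For c > 1 the quotient is at most zero. -/
theorem extQuot_le_of_sim {n : ℕ} (hn : 2 ≤ n) {a c : EReal} (ha : (n : EReal) ≤ a)
    (hc : (((n : ℝ)⁻¹ : ℝ) : EReal) ≤ c)
    (h : ∀ γ δ : ℝ, 1 ≤ n * γ → γ < 1 → (γ : EReal) < c → 0 < δ → δ * (1 - γ) < n - 1 →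
      (δ : EReal) ≤ a) :
    extQuot ((n : EReal) - 1) (1 - c) ≤ a := by
  have hn2 : (2 : ℝ) ≤ n := by exact_mod_cast hn
  have hn0 : (0 : ℝ) < n := by linarith
  have e1 : (n : EReal) - 1 = ((n - 1 : ℝ) : EReal) := by push_cast; rfl
  have ha0 : 0 ≤ a := le_trans (by positivity) ha
  rw [e1]
  induction c with
  | bot => exact absurd hc (by simp)
  | top =>
    have : (1 : EReal) - ⊤ = ⊥ := rfl
    rw [this, extQuot, if_neg, EReal.div_bot]
    · exact ha0
    · rintro (h | h)
      · simp at h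
      · exact EReal.coe_ne_top _ h
  | coe c =>
  have e2 : (1 : EReal) - (c : EReal) = ((1 - c : ℝ) : EReal) := by push_cast; rfl
  have hc' : (n : ℝ)⁻¹ ≤ c := by exact_mod_cast hc
  rw [e2]
  have key : c ≤ 1 → ∀ z : ℝ, z * (1 - c) < n - 1 → (z : EReal) ≤ a := by
    intro hc1 z hz
    rcases le_or_gt z n with hzn | hzn
    · exact le_trans (by exact_mod_cast hzn) ha
    have hcn : (n : ℝ)⁻¹ < c := by
      rcases hc'.lt_or_eq with h1 | h1
      · exact h1
      · exfalso
        rw [← h1] at hz hc1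
        have e3 : n * (1 - (n : ℝ)⁻¹) = n - 1 := by field_simp
        nlinarith
    have k1 : ∀ᶠ γ in nhds c, z * (1 - γ) < n - 1 :=
      (by fun_prop : Continuous fun γ : ℝ => z * (1 - γ)).continuousAt.eventually_lt_const hz
    obtain ⟨γ, ⟨k1, k2⟩, k3⟩ := (((k1.and (eventually_gt_nhds hcn)).filter_mono
      (nhdsWithin_le_nhds (s := Set.Iio c))).and self_mem_nhdsWithin).exists
    have k3' : γ < c := k3
    refine h γ z ?_ (by linarith) (by exact_mod_cast k3') (by linarith) k1
    rw [inv_lt_iff_one_lt_mul₀' hn0] at k2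
    exact k2.le
  rcases eq_or_ne c 1 with rfl | hc1
  · rw [sub_self, EReal.coe_zero, extQuot_zero, ← EReal.ge_of_forall_gt_iff_ge]
    intro z _
    exact key le_rfl z (by linarith)
  rw [extQuot_coe (sub_ne_zero.mpr hc1.symm)]
  rcases hc1.lt_or_gt with hlt | hgt
  · rw [← EReal.ge_of_forall_gt_iff_ge]
    intro z hz
    refine key hlt.le z ?_
    rw [EReal.coe_lt_coe_iff, lt_div_iff₀ (by linarith)] at hz
    exact hz
  · refine le_trans ?_ ha0
    have : (n - 1 : ℝ) / (1 - c) ≤ 0 := div_nonpos_of_nonneg_of_nonpos (by linarith) (by linarith)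
    exact_mod_cast this

/-- If a ≤ 1/b, the bound a/c ≤ 1 suffices. Otherwise exponents l just below a and w just below b
satisfy 1/w < l, and the hypotheses apply to them. -/
theorem le_extQuot_inv_of_regular {a b c : EReal} (ha : 0 < a) (hac : a ≤ c) (hb : 0 < b)
    (h1 : ∀ w l : ℝ, 0 < w → (w : EReal) < b → (l : EReal) < a → w⁻¹ < l → l ≤ 1 + w⁻¹)
    (h2 : ∀ w l v : ℝ, 0 < w → (w : EReal) < b → (l : EReal) < a → w⁻¹ < l → 0 < v →
      v * (1 + w⁻¹ - l) < l → (v : EReal) ≤ c) :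
    a ≤ extQuot (1 + b⁻¹) (1 + c⁻¹) := by
  obtain ⟨β, hβ, hβ0, -, hβlt⟩ := exists_inv_eq_coe hb
  obtain ⟨κ, hκ, hκ0, hκc, -⟩ := exists_inv_eq_coe (ha.trans_le hac)
  have e1 : (1 : EReal) + (β : EReal) = ((1 + β : ℝ) : EReal) := by push_cast; rfl
  have e2 : (1 : EReal) + (κ : EReal) = ((1 + κ : ℝ) : EReal) := by push_cast; rfl
  rw [hβ, hκ, e1, e2, extQuot_coe (by linarith)]
  induction a with
  | bot => exact absurd ha (by simp)
  | top =>
    exfalso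
    -- These values satisfy l = β + 3 > 1 + w⁻¹ = β + 2, against `h1`.
    have h := h1 (β + 1)⁻¹ (β + 3) (by positivity) (hβlt _ (by linarith)) (EReal.coe_lt_top _)
    rw [inv_inv] at h
    linarith [h (by linarith)]
  | coe a =>
  have ha0 : 0 < a := by exact_mod_cast ha
  rw [EReal.coe_le_coe_iff, le_div_iff₀ (by linarith)]
  rcases le_or_gt a β with hle | hgt
  · have : a * κ ≤ 1 := by
      rcases eq_or_ne κ 0 with h0 | h0
      · rw [h0]; linarith
      · rw [hκc h0, EReal.coe_le_coe_iff] at hac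
        rwa [← le_div_iff₀ (lt_of_le_of_ne hκ0 h0.symm), one_div]
    linarith
  have key : ∀ β' l, β < β' → l < a → β' < l → l * κ ≤ 1 + β' - l := by
    intro β' l hβ' hl hβl
    have hw0 : 0 < β'⁻¹ := inv_pos.mpr (by linarith)
    have hl' : (l : EReal) < (a : EReal) := by exact_mod_cast hl
    -- For κ = 0 the claim is `h1`; otherwise its failure would make some v > 1/κ = c admissible in
    -- `h2`.
    rcases eq_or_ne κ 0 with h0 | h0
    · have := h1 β'⁻¹ l hw0 (hβlt β' hβ') hl' (by rwa [inv_inv])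
      rw [inv_inv] at this
      rw [h0]
      linarith
    · have hκpos : 0 < κ := lt_of_le_of_ne hκ0 h0.symm
      by_contra! hlt
      have k1 : ∀ᶠ v in nhds κ⁻¹, v * (1 + β' - l) < l := by
        refine (by fun_prop : Continuous fun v : ℝ => v * (1 + β' - l)).continuousAt.eventually_lt_const
          ?_
        rwa [inv_mul_lt_iff₀ hκpos, mul_comm]
      obtain ⟨v, k1, k2⟩ := ((k1.filter_mono (nhdsWithin_le_nhds (s := Set.Ioi κ⁻¹))).and
        self_mem_nhdsWithin).exists
      have k2' : κ⁻¹ < v := k2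
      have h := h2 β'⁻¹ l v hw0 (hβlt β' hβ') hl' (by rwa [inv_inv])
        ((inv_pos.mpr hκpos).trans k2') (by rwa [inv_inv])
      rw [hκc h0, EReal.coe_le_coe_iff] at h
      linarith
  by_contra! hlt
  have k1 : ∀ᶠ ε in nhds (0 : ℝ), β + ε < a - ε :=
    Continuous.continuousAt (by fun_prop) |>.eventually_lt
      (Continuous.continuousAt (by fun_prop)) (by simpa using hgt)
  have k2 : ∀ᶠ ε in nhds (0 : ℝ), 1 + (β + ε) < (a - ε) * (1 + κ) :=
    Continuous.continuousAt (by fun_prop) |>.eventually_lt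
      (Continuous.continuousAt (by fun_prop)) (by simpa using hlt)
  obtain ⟨ε, ⟨k1, k2⟩, hε⟩ := (((k1.and k2).filter_mono
    (nhdsWithin_le_nhds (s := Set.Ioi 0))).and self_mem_nhdsWithin).exists
  have hε0 : 0 < ε := hε
  linarith [key (β + ε) (a - ε) (by linarith) (by linarith) k1]

/-- Numbers up to 1/n are below c by `hc`. A larger z forces 1/a < 1/n, so some β' between them
serves with γ = 1/β'. -/
theorem extQuot_le_of_lin {n : ℕ} (hn : 2 ≤ n) {a c : EReal} (ha : (n : EReal) ≤ a)
    (hc : (((n : ℝ)⁻¹ : ℝ) : EReal) ≤ c)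
    (h : ∀ γ δ : ℝ, n ≤ γ → (γ : EReal) < a → 0 < δ → δ * (n - 1) < 1 - γ⁻¹ → (δ : EReal) ≤ c) :
    extQuot (1 - a⁻¹) ((n : EReal) - 1) ≤ c := by
  have hn2 : (2 : ℝ) ≤ n := by exact_mod_cast hn
  have hn0 : (0 : ℝ) < n := by linarith
  have ha0 : 0 < a := lt_of_lt_of_le (by exact_mod_cast hn0) ha
  obtain ⟨β, hβ, hβ0, -, hβlt⟩ := exists_inv_eq_coe ha0
  have e1 : (n : EReal) - 1 = ((n - 1 : ℝ) : EReal) := by push_cast; rfl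
  have e2 : (1 : EReal) - (β : EReal) = ((1 - β : ℝ) : EReal) := by push_cast; rfl
  rw [hβ, e1, e2, extQuot_coe (by linarith), ← EReal.ge_of_forall_gt_iff_ge]
  intro z hz
  rw [EReal.coe_lt_coe_iff, lt_div_iff₀ (by linarith)] at hz
  rcases le_or_gt z (n : ℝ)⁻¹ with hzn | hzn
  · exact le_trans (by exact_mod_cast hzn) hc
  have hβn : β < (n : ℝ)⁻¹ := by
    have e3 : (n : ℝ)⁻¹ * (n - 1) = 1 - (n : ℝ)⁻¹ := by field_simp
    nlinarith
  obtain ⟨β', h3, h4⟩ := exists_between (lt_min hβn (by linarith : β < 1 - z * (n - 1)))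
  rw [lt_min_iff] at h4
  have hβ'0 : 0 < β' := by linarith
  refine h β'⁻¹ z ?_ (hβlt β' h3) ((inv_pos.mpr hn0).trans hzn) ?_
  · rw [le_inv_comm₀ hn0 hβ'0]; exact h4.1.le
  · rw [inv_inv]; linarith

/-! ### Exponents as suprema, and the conclusion -/

theorem SimSolvable.mono {n : ℕ} {θ : Fin n → ℝ} {γ γ' t : ℝ} (ht : 1 ≤ t) (hγ : γ ≤ γ')
    (h : SimSolvable θ γ' t) : SimSolvable θ γ t := by
  obtain ⟨x₀, x, h1, h2⟩ := h
  exact ⟨x₀, x, fun i => (h1 i).trans (Real.rpow_le_rpow_of_exponent_le ht (by linarith)), h2⟩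

theorem LinSolvable.mono {n : ℕ} {θ : Fin n → ℝ} {γ γ' t : ℝ} (ht : 1 ≤ t) (hγ : γ ≤ γ')
    (h : LinSolvable θ γ' t) : LinSolvable θ γ t := by
  obtain ⟨x₀, x, h1, h2⟩ := h
  exact ⟨x₀, x, h1.trans (Real.rpow_le_rpow_of_exponent_le ht (by linarith)), h2⟩

theorem exists_gt_of_lt_sSup {P : ℝ → Prop} {γ : ℝ}
    (h : (γ : EReal) < sSup ((fun γ : ℝ => (γ : EReal)) '' {γ | P γ})) : ∃ γ', γ < γ' ∧ P γ' := by
  obtain ⟨-, ⟨γ', hP, rfl⟩, hlt⟩ := lt_sSup_iff.mp h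
  exact ⟨γ', EReal.coe_lt_coe_iff.mp hlt, hP⟩

theorem le_sSup_coe {P : ℝ → Prop} {γ : ℝ} (h : P γ) :
    (γ : EReal) ≤ sSup ((fun γ : ℝ => (γ : EReal)) '' {γ | P γ}) :=
  le_sSup ⟨γ, h, rfl⟩

/-- The supremum supplies only some larger admissible exponent; solvability passes to smaller ones
once t ≥ 1. -/
theorem eventually_sim_of_lt {n : ℕ} {θ : Fin n → ℝ} {γ : ℝ} (h : (γ : EReal) < simUnifExp θ) :
    ∀ᶠ t : ℝ in atTop, SimSolvable θ γ t := by
  obtain ⟨γ', hlt, hP⟩ := exists_gt_of_lt_sSup h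
  filter_upwards [hP, eventually_ge_atTop 1] with t ht h1 using ht.mono h1 hlt.le

theorem eventually_lin_of_lt {n : ℕ} {θ : Fin n → ℝ} {γ : ℝ} (h : (γ : EReal) < linUnifExp θ) :
    ∀ᶠ t : ℝ in atTop, LinSolvable θ γ t := by
  obtain ⟨γ', hlt, hP⟩ := exists_gt_of_lt_sSup h
  filter_upwards [hP, eventually_ge_atTop 1] with t ht h1 using ht.mono h1 hlt.le

theorem frequently_sim_of_lt {n : ℕ} {θ : Fin n → ℝ} {γ : ℝ} (h : (γ : EReal) < simExp θ) :
    ∃ᶠ t : ℝ in atTop, SimSolvable θ γ t := by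
  obtain ⟨γ', hlt, hP⟩ := exists_gt_of_lt_sSup h
  exact (hP.and_eventually (eventually_ge_atTop 1)).mono fun t ht => ht.1.mono ht.2 hlt.le

theorem frequently_lin_of_lt {n : ℕ} {θ : Fin n → ℝ} {γ : ℝ} (h : (γ : EReal) < linExp θ) :
    ∃ᶠ t : ℝ in atTop, LinSolvable θ γ t := by
  obtain ⟨γ', hlt, hP⟩ := exists_gt_of_lt_sSup h
  exact (hP.and_eventually (eventually_ge_atTop 1)).mono fun t ht => ht.1.mono ht.2 hlt.le

theorem simUnifExp_le_simExp {n : ℕ} (θ : Fin n → ℝ) : simUnifExp θ ≤ simExp θ :=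
  sSup_le_sSup (Set.image_mono fun _ h => Eventually.frequently h)

theorem linUnifExp_le_linExp {n : ℕ} (θ : Fin n → ℝ) : linUnifExp θ ≤ linExp θ :=
  sSup_le_sSup (Set.image_mono fun _ h => Eventually.frequently h)

theorem inv_le_simUnifExp {n : ℕ} (hn : 1 ≤ n) (θ : Fin n → ℝ) :
    (((n : ℝ)⁻¹ : ℝ) : EReal) ≤ simUnifExp θ := by
  have hn0 : (0 : ℝ) < n := by exact_mod_cast hn
  rw [← EReal.ge_of_forall_gt_iff_ge]
  intro z hz
  obtain ⟨γ, h1, h2⟩ := exists_between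
    (max_lt (inv_pos.mpr hn0) (EReal.coe_lt_coe_iff.mp hz) : max 0 z < (n : ℝ)⁻¹)
  rw [max_lt_iff] at h1
  refine le_trans (by exact_mod_cast h1.2.le) (le_sSup_coe (γ := γ) ?_)
  exact simSolvable_of_mul_lt_one θ h1.1 (by rwa [← lt_inv_mul_iff₀ hn0, mul_one])

theorem natCast_le_linUnifExp {n : ℕ} (hn : 1 ≤ n) (θ : Fin n → ℝ) :
    (n : EReal) ≤ linUnifExp θ := by
  have hn0 : (0 : ℝ) < n := by exact_mod_cast hn
  rw [← EReal.ge_of_forall_gt_iff_ge]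
  intro z hz
  obtain ⟨γ, h1, h2⟩ := exists_between
    (max_lt hn0 (by exact_mod_cast hz) : max 0 z < (n : ℝ))
  rw [max_lt_iff] at h1
  exact le_trans (by exact_mod_cast h1.2.le) (le_sSup_coe (γ := γ) (linSolvable_of_lt θ h1.1 h2))

theorem mainTheorem10 (n : ℕ) (hn : 2 ≤ n) (θ : Fin n → ℝ)
    (hθ : LinearIndependent ℚ (Fin.cons 1 θ : Fin (n + 1) → ℝ)) :
    -- the first chain
    (linUnifExp θ ≤ extQuot (1 + linExp θ) (1 + simExp θ) ∧
      extQuot ((n : EReal) - 1) (1 - simUnifExp θ) ≤ linUnifExp θ) ∧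
    -- the second chain
    (simUnifExp θ ≤ extQuot (1 + (linExp θ)⁻¹) (1 + (simExp θ)⁻¹) ∧
      extQuot (1 - (linUnifExp θ)⁻¹) ((n : EReal) - 1) ≤ simUnifExp θ) ∧
    -- the Bugeaud-Laurent inequalities
    (extQuot ((n : EReal) - 1) (1 - simUnifExp θ) ≤ extQuot (1 + linExp θ) (1 + simExp θ) ∧
      extQuot (1 - (linUnifExp θ)⁻¹) ((n : EReal) - 1) ≤
        extQuot (1 + (linExp θ)⁻¹) (1 + (simExp θ)⁻¹)) := by
  have hn1 : 1 ≤ n := by omega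
  have hn2 : (2 : ℝ) ≤ n := by exact_mod_cast hn
  have hn0 : (0 : ℝ) < n := by linarith
  have hsim := inv_le_simUnifExp hn1 θ
  have hlin := natCast_le_linUnifExp hn1 θ
  have hsim0 : 0 < simUnifExp θ := lt_of_lt_of_le (by exact_mod_cast inv_pos.mpr hn0) hsim
  have hlin0 : 0 < linUnifExp θ := lt_of_lt_of_le (by exact_mod_cast hn0) hlin
  have h1 : linUnifExp θ ≤ extQuot (1 + linExp θ) (1 + simExp θ) := by
    refine le_extQuot_of_regular hlin0 (linUnifExp_le_linExp θ)
      (hsim0.trans_le (simUnifExp_le_simExp θ)) fun u v hu0 hv0 hu hv huv => ?_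
    rw [← EReal.ge_of_forall_gt_iff_ge]
    intro w hw
    exact le_sSup_coe (frequently_linSolvable hn1 hθ hu0 hv0 huv (by exact_mod_cast hw)
      (eventually_lin_of_lt hu) (frequently_sim_of_lt hv))
  have h2 : extQuot ((n : EReal) - 1) (1 - simUnifExp θ) ≤ linUnifExp θ :=
    extQuot_le_of_sim hn hlin hsim fun γ δ hγn hγ1 hγ hδ0 hδ =>
      le_sSup_coe (eventually_linSolvable_of_sim hn1 θ hγn hγ1 hδ0 hδ (eventually_sim_of_lt hγ))
  have h3 : simUnifExp θ ≤ extQuot (1 + (linExp θ)⁻¹) (1 + (simExp θ)⁻¹) :=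
    le_extQuot_inv_of_regular hsim0 (simUnifExp_le_simExp θ)
      (hlin0.trans_le (linUnifExp_le_linExp θ))
      (fun w l hw0 hw hl hwl => uniform_sim_le hn1 hθ hw0 hwl (frequently_lin_of_lt hw)
        (eventually_sim_of_lt hl))
      fun w l v hw0 hw hl hwl hv0 hv => le_sSup_coe (frequently_simSolvable hn1 hθ hw0 hwl hv0 hv
        (frequently_lin_of_lt hw) (eventually_sim_of_lt hl))
  have h4 : extQuot (1 - (linUnifExp θ)⁻¹) ((n : EReal) - 1) ≤ simUnifExp θ :=
    extQuot_le_of_lin hn hlin hsim fun γ δ hγn hγ hδ0 hδ =>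
      le_sSup_coe (eventually_simSolvable_of_lin hn1 θ hγn (by linarith) hδ0 hδ
        (eventually_lin_of_lt hγ))
  exact ⟨⟨h1, h2⟩, ⟨h3, h4⟩, h2.trans h1, h4.trans h3⟩
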